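/- Let $q\ge 0$ and $\mu>0$, let $\pi:\mathbb C^{q+1}\setminus\{0\}\to\mathbb CP^q$ be the projection and $x(z)=\sum_A|z^A|^2$. Let $\lambda$ be a formal parameter. On $\mathbb C^{q+1}\setminus\{0\}$ take the symplectic form $\frac i2\sum_A dz^A\wedge d\bar z_A$ with its Poisson bracket $\{\cdot,\cdot\}$, and the Wick product (repeated indices are summed over) $$F\,\tilde*\,G=\sum_{r\ge0}\frac{\lambda^r}{r!}\,\frac{\partial^rF}{\partial z^{A_1}\cdots\partial z^{A_r}}\,\frac{\partial^rG}{\partial\bar z_{A_1}\cdots\partial\bar z_{A_r}} .$$ Call a smooth function on $\mathbb C^{q+1}\setminus\{0\}$ invariant if it is invariant under multiplication by $U(1)$, and homogeneous if it is invariant under multiplication by $\mathbb C\setminus\{0\}$. Let $\mathcal J$ be the set of all $G\,\tilde*\,(x-\mu)$ where $G$ is a formal power series in $\lambda$ of invariant smooth functions. For a formal power series $F$ of invariant smooth functions let $P(F)$ denote its homogeneous part, i.e. the unique formal power series $H$ of homogeneous smooth functions with $F-H\in\mathcal J$. Put $c=\mu\lambda^{-1}+1$ and $[c]_r=c(c+1)\cdots(c+r-1)$,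 $[c]_0=1$. Then there is a star product $*$ on $\mathbb CP^q$ such that for all $f,g\in C^\infty(\mathbb CP^q)$ $$\pi^*(f*g)=P(\pi^*f\,\tilde*\,\pi^*g)=\sum_{r=0}^\infty\frac1{r!\,[c]_r}\,M_r(\pi^*f,\pi^*g),$$ where $$M_r(F,G)=x^r\,\frac{\partial^rF}{\partial z^{A_1}\cdots\partial z^{A_r}}\,\frac{\partial^rG}{\partial\bar z_{A_1}\cdots\partial\bar z_{A_r}} .$$ (In particular, the homogeneous part $P(\pi^*f\,\tilde*\,\pi^*g)$ exists and is unique.) Each $1/(r!\,[c]_r)$ is a formal power series in $\lambda$ of order at least $r$, so that the sum is finite in each order of $\lambda$. For $F=\pi^*f$ and $G=\pi^*g$ the function $M_r(F,G)$ is smooth and homogeneous, and $$M_r(F,G)(z)=\mu^r\left(\frac{\partial^rF}{\partial z^{A_1}\cdots\partial z^{A_r}}\,\frac{\partial^rG}{\partial\bar z_{A_1}\cdots\partial\bar z_{A_r}}\right)\!\bigl(\mu^{1/2}x(z)^{-1/2}z\bigr).$$ Here a star product on $\mathbb CP^q$ is a $\mathbb C[[\lambda]]$-bilinear associative product on $C^\infty(\mathbb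 CP^q)[[\lambda]]$ (complex-valued smooth functions) with unit the constant function $1$, such that: on $C^\infty(\mathbb CP^q)$ the coefficient of each power of $\lambda$ is a bidifferential operator; $f*g=fg+O(\lambda)$; $f*g-g*f=\frac{i\lambda}2\{f,g\}_\mu+O(\lambda^2)$, where $\{f,g\}_\mu$ is the reduced Poisson bracket, $\{f,g\}_\mu(\pi(\zeta))=\{\pi^*f,\pi^*g\}(\zeta)$ for $x(\zeta)=\mu$; and $\overline{a*b}=\bar b*\bar a$ for all $a,b\in C^\infty(\mathbb CP^q)[[\lambda]]$, where $\bar\lambda=\lambda$. -/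

import Mathlib

open scoped ContDiff PowerSeries

noncomputable section

namespace CPStar

/-! ### Complex projective space and its smooth functions -/

/-- The total space `ℂ^{q+1}`; only its points `z ≠ 0` matter below. -/
abbrev V (q : ℕ) : Type := Fin (q + 1) → ℂ

/-- The complex projective space `CP^q`, the quotient of `ℂ^{q+1} \ {0}` by nonzero scalars. -/
abbrev CP (q : ℕ) : Type := Projectivization ℂ (V q)

theorem insertNth_one_ne_zero {q : ℕ} (i : Fin (q + 1)) (w : Fin q → ℂ) :
    (i.insertNth (1 : ℂ) w : V q) ≠ 0 := by
  intro h
  have h1 := congrFun h i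
  simp at h1

/-- The inverse of the `i`-th affine chart, `w ↦ [w_0 : … : 1 : … : w_{q-1}]`
with the entry `1` in position `i`. -/
def affine {q : ℕ} (i : Fin (q + 1)) (w : Fin q → ℂ) : CP q :=
  Projectivization.mk ℂ (i.insertNth (1 : ℂ) w : V q) (insertNth_one_ne_zero i w)

/-- The algebra `C^∞(CP^q)` of complex valued functions that are smooth (over `ℝ`) in each of the
`q + 1` affine charts, with pointwise operations and pointwise complex conjugation. -/
def Smooth (q : ℕ) : StarSubalgebra ℂ (CP q → ℂ) where
  carrier := {f | ∀ i : Fin (q + 1), ContDiff ℝ ∞ (fun w => f (affine i w))}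
  mul_mem' := fun hf hg i => (hf i).mul (hg i)
  add_mem' := fun hf hg i => (hf i).add (hg i)
  algebraMap_mem' := fun _ _ => contDiff_const
  star_mem' := fun hf i => Complex.conjCLE.contDiff.comp (hf i)

/-- The pullback `π^* f` along `π : ℂ^{q+1} \ {0} → CP^q` (with the irrelevant value `0` at the
origin). -/
def pullback {q : ℕ} (f : Smooth q) (z : V q) : ℂ :=
  open Classical in if hz : z ≠ 0 then f.1 (Projectivization.mk ℂ z hz) else 0

/-! ### Differential operators on `ℂ^{q+1}` -/

/-- The Wirtinger derivative `∂F/∂z^A`. -/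
def dz {q : ℕ} (A : Fin (q + 1)) (F : V q → ℂ) (z : V q) : ℂ :=
  (1 / 2) * (fderiv ℝ F z (Pi.single A 1) - Complex.I * fderiv ℝ F z (Pi.single A Complex.I))

/-- The Wirtinger derivative `∂F/∂z̄_A`. -/
def dzbar {q : ℕ} (A : Fin (q + 1)) (F : V q → ℂ) (z : V q) : ℂ :=
  (1 / 2) * (fderiv ℝ F z (Pi.single A 1) + Complex.I * fderiv ℝ F z (Pi.single A Complex.I))

/-- The iterated derivative `∂^r F / ∂z^{A_1} … ∂z^{A_r}`. -/
def dzIter {q r : ℕ} (A : Fin r → Fin (q + 1)) (F : V q → ℂ) : V q → ℂ :=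
  (List.ofFn A).foldr dz F

/-- The iterated derivative `∂^r F / ∂z̄_{A_1} … ∂z̄_{A_r}`. -/
def dzbarIter {q r : ℕ} (A : Fin r → Fin (q + 1)) (F : V q → ℂ) : V q → ℂ :=
  (List.ofFn A).foldr dzbar F

/-- The sum over `A_1, …, A_r` of
`∂^r F / ∂z^{A_1} … ∂z^{A_r} · ∂^r G / ∂z̄_{A_1} … ∂z̄_{A_r}`. -/
def contraction {q : ℕ} (r : ℕ) (F G : V q → ℂ) (z : V q) : ℂ :=
  ∑ A : Fin r → Fin (q + 1), dzIter A F z * dzbarIter A G z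

/-- The function `x = z† z = ∑_A |z^A|²`. -/
def x {q : ℕ} (z : V q) : ℝ := ∑ A, ‖z A‖ ^ 2

/-- The operator `M_r(F, G) = x^r ∂^r F / ∂z^{A_1} … ∂z^{A_r} · ∂^r G / ∂z̄_{A_1} … ∂z̄_{A_r}`. -/
def M {q : ℕ} (r : ℕ) (F G : V q → ℂ) (z : V q) : ℂ :=
  (x z : ℂ) ^ r * contraction r F G z

/-- The retraction `z ↦ z x^{-1/2} μ^{1/2}` of `ℂ^{q+1} \ {0}` onto the level set `x = μ`. -/
def retract {q : ℕ} (μ : ℝ) (z : V q) : V q := (Real.sqrt μ / Real.sqrt (x z)) • z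

/-- The Poisson bracket of the symplectic form
`(i/2) ∑ dz^A ∧ dz̄_A = ∑ d(Re z^A) ∧ d(Im z^A)` on `ℂ^{q+1}`. -/
def poisson {q : ℕ} (F G : V q → ℂ) (z : V q) : ℂ :=
  ∑ A : Fin (q + 1),
    (fderiv ℝ F z (Pi.single A 1) * fderiv ℝ G z (Pi.single A Complex.I)
      - fderiv ℝ F z (Pi.single A Complex.I) * fderiv ℝ G z (Pi.single A 1))

/-! ### The Wick product, the star ideal and the projection

Formal power series in `λ` of functions on `ℂ^{q+1} \ {0}` are written as power series with
coefficients in `V q → ℂ`; they are compared at points `z ≠ 0` only. -/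

/-- The Wick product
`F ⋆ G = ∑_r (λ^r / r!) ∂^r F / ∂z^{A_1} … ∂z^{A_r} · ∂^r G / ∂z̄_{A_1} … ∂z̄_{A_r}`,
extended `ℂ⟦λ⟧`-bilinearly to formal power series. -/
def wick {q : ℕ} (F G : (V q → ℂ)⟦X⟧) : (V q → ℂ)⟦X⟧ :=
  PowerSeries.mk fun n z =>
    ∑ p ∈ Finset.HasAntidiagonal.antidiagonal n, ((p.1.factorial : ℂ)⁻¹) *
      ∑ s ∈ Finset.HasAntidiagonal.antidiagonal p.2,
        contraction p.1 (PowerSeries.coeff s.1 F) (PowerSeries.coeff s.2 G) z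

/-- Smooth functions on `ℂ^{q+1} \ {0}` that are invariant under `U(1)`. -/
def IsInvariant {q : ℕ} (F : V q → ℂ) : Prop :=
  ContDiffOn ℝ ∞ F {0}ᶜ ∧ ∀ u : ℂ, ‖u‖ = 1 → ∀ z : V q, z ≠ 0 → F (u • z) = F z

/-- Smooth functions on `ℂ^{q+1} \ {0}` that are homogeneous, i.e. invariant under
`GL(1, ℂ) = ℂ \ {0}`. -/
def IsHomogeneous {q : ℕ} (F : V q → ℂ) : Prop :=
  ContDiffOn ℝ ∞ F {0}ᶜ ∧ ∀ u : ℂ, u ≠ 0 → ∀ z : V q, z ≠ 0 → F (u • z) = F z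

/-- The star ideal `⟨x - μ⟩`: all `G ⋆ (x - μ)` with `G` a formal power series of invariant smooth
functions (on `ℂ^{q+1} \ {0}`). -/
def starIdeal (q : ℕ) (μ : ℝ) : Set (V q → ℂ)⟦X⟧ :=
  {K | ∃ G : (V q → ℂ)⟦X⟧, (∀ n, IsInvariant (PowerSeries.coeff n G)) ∧
    ∀ n, ∀ z : V q, z ≠ 0 → PowerSeries.coeff n K z =
      PowerSeries.coeff n (wick G (PowerSeries.C (fun z : V q => ((x z - μ : ℝ) : ℂ)))) z}

/-- `H` is the homogeneous part `P(F)` of `F` in the decomposition of the formal series of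
invariant functions into homogeneous ones and the star ideal of `x - μ`. -/
def IsHomogeneousPart {q : ℕ} (μ : ℝ) (F H : (V q → ℂ)⟦X⟧) : Prop :=
  (∀ n, IsHomogeneous (PowerSeries.coeff n H)) ∧ F - H ∈ starIdeal q μ

/-! ### The coefficients `1 / [c]_r` -/

/-- `c = μ / λ + 1`, in the field of formal Laurent series in `λ`. -/
def c (μ : ℝ) : LaurentSeries ℂ := HahnSeries.single (-1 : ℤ) (μ : ℂ) + 1

/-- `1 / (r! [c]_r)` with `[c]_r = c (c + 1) ⋯ (c + r - 1)`, in the field of formal Laurent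
series in `λ`. -/
def weight (μ : ℝ) (r : ℕ) : LaurentSeries ℂ :=
  1 / ((r.factorial : LaurentSeries ℂ) * (ascPochhammer (LaurentSeries ℂ) r).eval (c μ))

/-! ### Star products on `CP^q` -/

/-- The real basis vector of `ℂ^q` in the direction `Re w_a` (for `(a, false)`) or `Im w_a`
(for `(a, true)`). -/
def realBasis {q : ℕ} (d : Fin q × Bool) : Fin q → ℂ :=
  Pi.single d.1 (if d.2 then Complex.I else 1)

/-- `B` is a bidifferential operator on `CP^q`: in each affine chart it is a finite sum of products
of partial derivatives of the two arguments, with smooth coefficients. -/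
def IsBidifferential {q : ℕ} (B : Smooth q → Smooth q → Smooth q) : Prop :=
  ∀ i : Fin (q + 1), ∃ N : ℕ,
    ∃ a : (k l : ℕ) → (Fin k → Fin q × Bool) → (Fin l → Fin q × Bool) → (Fin q → ℂ) → ℂ,
      (∀ k l S T, ContDiff ℝ ∞ (a k l S T)) ∧
      ∀ (f g : Smooth q) (w : Fin q → ℂ),
        (B f g).1 (affine i w) =
          ∑ k ∈ Finset.range (N + 1), ∑ l ∈ Finset.range (N + 1),
            ∑ S : Fin k → Fin q × Bool, ∑ T : Fin l → Fin q × Bool,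
              a k l S T w
                * iteratedFDeriv ℝ k (fun v => f.1 (affine i v)) w (fun j => realBasis (S j))
                * iteratedFDeriv ℝ l (fun v => g.1 (affine i v)) w (fun j => realBasis (T j))

/-- A `ℂ⟦λ⟧`-bilinear product on `C^∞(CP^q)⟦λ⟧` is a star product for `CP^q` as the reduced phase
space of `ℂ^{q+1}` at `x = μ`. -/
structure IsStarProduct {q : ℕ} (μ : ℝ)
    (m : (Smooth q)⟦X⟧ →ₗ[ℂ⟦X⟧] (Smooth q)⟦X⟧ →ₗ[ℂ⟦X⟧] (Smooth q)⟦X⟧) : Prop where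
  assoc : ∀ a b d, m (m a b) d = m a (m b d)
  one_left : ∀ a, m 1 a = a
  one_right : ∀ a, m a 1 = a
  /-- In order zero it is the pointwise product. -/
  zeroth : ∀ f g : Smooth q,
    PowerSeries.coeff 0 (m (PowerSeries.C f) (PowerSeries.C g)) = f * g
  /-- In order one the commutator is `i/2` times the reduced Poisson bracket, whose value at `[ζ]`
  for `ζ` in the level set `x = μ` is the Poisson bracket of the pullbacks at `ζ`. -/
  first_order : ∀ (f g : Smooth q) (ζ : V q) (hζ : ζ ≠ 0), x ζ = μ →
    (PowerSeries.coeff 1 (m (PowerSeries.C f) (PowerSeries.C g)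
        - m (PowerSeries.C g) (PowerSeries.C f))).1 (Projectivization.mk ℂ ζ hζ)
      = Complex.I / 2 * poisson (pullback f) (pullback g) ζ
  /-- Complex conjugation (with `λ` real) is an antilinear involution. -/
  conj : ∀ a b, PowerSeries.map (starRingEnd (Smooth q)) (m a b)
    = m (PowerSeries.map (starRingEnd (Smooth q)) b) (PowerSeries.map (starRingEnd (Smooth q)) a)
  bidifferential : ∀ n, IsBidifferential
    fun f g : Smooth q => PowerSeries.coeff n (m (PowerSeries.C f) (PowerSeries.C g))

end CPStar

end

/-! The product on `CP^q` is the Wick product of homogeneous functions, reduced modulo the star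
ideal of `x - μ`. Everything takes place in the ring `S q` of smooth functions on the punctured
space, where the Wirtinger derivatives are commuting derivations; the Wick product is the
exponential of `λ ∑ ∂_A ⊗ ∂̄_A` followed by multiplication, and is therefore associative
(`wickCoeff_assoc`).

Let `EZ` and `EB` be the two Euler derivations. Since `x` is linear in `z` and in `z̄`, Wick
multiplication by `x - μ` on the right (left) is pointwise multiplication plus `λ EZ` (`λ EB`).
These derivations agree on `U(1)`-invariant functions, so `x - μ` is central among invariant series
(`wickS_xm_comm`) and its star ideal `starJ` is two-sided there.

Two facts make homogeneous functions represent the classes that are needed. First, a homogeneous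
series in the ideal is zero (`eq_zero_of_mem_starJ`). Second, for homogeneous `H`, taking `G = H
x^{-(r+1)}` as multiplier of `x - μ` gives `H x^{-r} ≡ (μ + (r+1)λ) H x^{-(r+1)}`, because `EZ G =
-(r+1) G` (`xinv_pow_step`). Iterating, `H x^{-r} ≡ H / ((μ+λ)⋯(μ+rλ))`. The `r`-th Wick term is
`λ^r/r!` times `x^{-r} M_r` with `M_r` homogeneous, so its homogeneous part is `M_r` times `λ^r /
(r! (μ+λ)⋯(μ+rλ)) = 1/(r! [c]_r)`. No decomposition of arbitrary invariant functions is needed.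

Both bracketings of a triple product are congruent to the triple Wick product; their difference is
homogeneous and in the ideal, hence zero (`starMul_assoc`). The unit, Poisson bracket and
conjugation properties are read off from the explicit formula. Bidifferentiality follows by writing
derivatives of pullbacks in a chart with the chain rule (`IsDiffOp.fderiv_apply`) and restricting to
the slice `z_i = 1`. -/

noncomputable section

namespace CPStar

/-! ### Formal power series with coefficients in an algebra -/

section Series

open PowerSeries Finset

variable {R A B : Type*} [CommRing R] [CommRing A] [CommRing B] [Algebra R A] [Algebra R B]

/-- The formal sum `∑_k X^k F_k`. -/
def sumX (F : ℕ → A⟦X⟧) : A⟦X⟧ :=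
  PowerSeries.mk fun n => ∑ p ∈ antidiagonal n, coeff p.2 (F p.1)

theorem coeff_sumX (F : ℕ → A⟦X⟧) (n : ℕ) :
    coeff n (sumX F) = ∑ p ∈ antidiagonal n, coeff p.2 (F p.1) := by
  simp [sumX]

theorem sumX_eq_add (F : ℕ → A⟦X⟧) :
    sumX F = F 0 + X * sumX fun k => F (k + 1) := by
  ext n
  cases n with
  | zero => simp [coeff_sumX]
  | succ n => simp [coeff_sumX, coeff_succ_X_mul, Finset.Nat.sum_antidiagonal_succ]

theorem sumX_X_mul (F : ℕ → A⟦X⟧) : (sumX fun k => X * F k) = X * sumX F := by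
  ext n
  cases n with
  | zero => simp [coeff_sumX]
  | succ n => simp [coeff_sumX, coeff_succ_X_mul, Finset.Nat.sum_antidiagonal_succ']

theorem sumX_sub (F G : ℕ → A⟦X⟧) : (sumX fun k => F k - G k) = sumX F - sumX G := by
  ext n
  simp [coeff_sumX]

theorem sumX_C (g : ℕ → A) : (sumX fun k => C (g k)) = PowerSeries.mk g := by
  ext n
  rw [coeff_sumX, Finset.sum_eq_single (n, 0)]
  · simp
  · rintro ⟨i, j⟩ h1 h2
    have : j ≠ 0 := by
      rintro rfl
      simp_all
    simp [coeff_C, this]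
  · simp

theorem eq_sumX (a : A⟦X⟧) : a = sumX fun k => C (coeff k a) := by
  rw [sumX_C]
  ext n
  simp

/-- Additive maps commuting with `X` are automatically continuous: peeling off the first summand
puts a factor `X` in front of the rest, so each coefficient sees only finitely many summands. -/
theorem map_sumX (T : A⟦X⟧ →+ B⟦X⟧) (hT : ∀ a, T (X * a) = X * T a) (F : ℕ → A⟦X⟧) :
    T (sumX F) = sumX fun k => T (F k) := by
  ext n
  induction n generalizing F with
  | zero =>
    rw [sumX_eq_add F, sumX_eq_add fun k => T (F k)]
    simp [hT]
  | succ n ih =>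
    rw [sumX_eq_add F, sumX_eq_add fun k => T (F k), map_add, hT]
    simp only [map_add, coeff_succ_X_mul, ih]

theorem sumX_zero : (sumX fun _ => (0 : A⟦X⟧)) = 0 := by
  ext n
  simp [coeff_sumX]

/-- Every series is a formal sum of constants, so a property closed under formal sums needs checking
on constants only. This and `addHom_ext` are the tools for passing from functions to series. -/
theorem map_mem_of_C (T : A⟦X⟧ →+ B⟦X⟧) (hT : ∀ a, T (X * a) = X * T a) (J : Set B⟦X⟧)
    (hJ : ∀ F : ℕ → B⟦X⟧, (∀ k, F k ∈ J) → sumX F ∈ J) (h : ∀ f, T (C f) ∈ J) (a : A⟦X⟧) :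
    T a ∈ J := by
  rw [eq_sumX a, map_sumX T hT]
  exact hJ _ fun k => h _

theorem addHom_ext (T T' : A⟦X⟧ →+ B⟦X⟧) (hT : ∀ a, T (X * a) = X * T a)
    (hT' : ∀ a, T' (X * a) = X * T' a) (h : ∀ f, T (C f) = T' (C f)) (a : A⟦X⟧) :
    T a = T' a := by
  rw [eq_sumX a, map_sumX T hT, map_sumX T' hT']
  simp only [h]

theorem series_smul_def (c : R⟦X⟧) (a : A⟦X⟧) :
    c • a = PowerSeries.map (algebraMap R A) c * a := by
  rw [Algebra.smul_def, PowerSeries.algebraMap_apply'']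

theorem map_series_smul (T : A⟦X⟧ →+ B⟦X⟧) (hT : ∀ a, T (X * a) = X * T a)
    (h : ∀ (r : R) (f : A⟦X⟧), T (C (algebraMap R A r) * f) = C (algebraMap R B r) * T f)
    (c : R⟦X⟧) (a : A⟦X⟧) : T (c • a) = c • T a := by
  -- With `a` fixed, both sides are additive in the scalar series and commute with `X`, so constant
  -- scalars suffice.
  refine addHom_ext (A := R) (T.comp
      ((AddMonoidHom.mulRight a).comp (PowerSeries.map (algebraMap R A)).toAddMonoidHom))
    ((AddMonoidHom.mulRight (T a)).comp (PowerSeries.map (algebraMap R B)).toAddMonoidHom)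
    ?_ ?_ ?_ c |>.trans ?_ |>.symm.trans ?_ |>.symm
  all_goals simp [series_smul_def, mul_assoc, hT, h]

/-! ### Extension of bilinear maps to formal power series -/

/-- The `n`-th coefficient of the extension of a sequence of bilinear maps. -/
def bilinFun (β : ℕ → A →ₗ[R] A →ₗ[R] B) (a b : A⟦X⟧) : B⟦X⟧ :=
  PowerSeries.mk fun n => ∑ p ∈ antidiagonal n, ∑ s ∈ antidiagonal p.2,
    β p.1 (coeff s.1 a) (coeff s.2 b)

theorem bilinFun_eq_sumX (β : ℕ → A →ₗ[R] A →ₗ[R] B) (a b : A⟦X⟧) :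
    bilinFun β a b = sumX fun p => sumX fun s => sumX fun t =>
      C (β p (coeff s a) (coeff t b)) := by
  ext n
  simp [bilinFun, coeff_sumX, sumX_C]

theorem bilinFun_X_mul_left (β : ℕ → A →ₗ[R] A →ₗ[R] B) (a b : A⟦X⟧) :
    bilinFun β (X * a) b = X * bilinFun β a b := by
  rw [bilinFun_eq_sumX, bilinFun_eq_sumX, ← sumX_X_mul]
  congr 1
  funext p
  rw [sumX_eq_add]
  simp [coeff_succ_X_mul, sumX_zero]

theorem bilinFun_X_mul_right (β : ℕ → A →ₗ[R] A →ₗ[R] B) (a b : A⟦X⟧) :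
    bilinFun β a (X * b) = X * bilinFun β a b := by
  rw [bilinFun_eq_sumX, bilinFun_eq_sumX, ← sumX_X_mul]
  congr 1
  funext p
  rw [← sumX_X_mul]
  congr 1
  funext s
  rw [sumX_eq_add]
  simp [coeff_succ_X_mul]

/-- The extension of the formal series `∑_n X^n β_n` of bilinear maps to formal power series. -/
def seriesBilin (β : ℕ → A →ₗ[R] A →ₗ[R] B) : A⟦X⟧ →ₗ[R⟦X⟧] A⟦X⟧ →ₗ[R⟦X⟧] B⟦X⟧ :=
  LinearMap.mk₂ R⟦X⟧ (bilinFun β)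
    (fun a a' b => by ext n; simp [bilinFun, Finset.sum_add_distrib])
    (fun c a b => map_series_smul
      (AddMonoidHom.mk' (fun a => bilinFun β a b)
        fun a a' => by ext n; simp [bilinFun, Finset.sum_add_distrib])
      (fun a => bilinFun_X_mul_left β a b)
      (fun r a => by
        ext n
        simp [bilinFun, ← Algebra.smul_def, Finset.smul_sum]) c a)
    (fun a b b' => by ext n; simp [bilinFun, Finset.sum_add_distrib])
    (fun c a b => map_series_smul
      (AddMonoidHom.mk' (fun b => bilinFun β a b)
        fun a a' => by ext n; simp [bilinFun, Finset.sum_add_distrib])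
      (fun b => bilinFun_X_mul_right β a b)
      (fun r a => by
        ext n
        simp [bilinFun, ← Algebra.smul_def, Finset.smul_sum]) c b)

theorem coeff_seriesBilin (β : ℕ → A →ₗ[R] A →ₗ[R] B) (a b : A⟦X⟧) (n : ℕ) :
    coeff n (seriesBilin β a b) = ∑ p ∈ antidiagonal n, ∑ s ∈ antidiagonal p.2,
      β p.1 (coeff s.1 a) (coeff s.2 b) := by
  change coeff n (bilinFun β a b) = _
  simp [bilinFun]

theorem seriesBilin_X_mul_left (β : ℕ → A →ₗ[R] A →ₗ[R] B) (a b : A⟦X⟧) :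
    seriesBilin β (X * a) b = X * seriesBilin β a b :=
  bilinFun_X_mul_left β a b

theorem seriesBilin_X_mul_right (β : ℕ → A →ₗ[R] A →ₗ[R] B) (a b : A⟦X⟧) :
    seriesBilin β a (X * b) = X * seriesBilin β a b :=
  bilinFun_X_mul_right β a b

theorem seriesBilin_C (β : ℕ → A →ₗ[R] A →ₗ[R] B) (f g : A) :
    seriesBilin β (C f) (C g) = PowerSeries.mk fun n => β n f g := by
  change bilinFun β _ _ = _
  rw [bilinFun_eq_sumX, ← sumX_C]
  congr 1
  funext p
  rw [sumX_eq_add]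
  have h : (sumX fun t => C (β p f (coeff t (C g)))) = C (β p f g) := by
    rw [sumX_eq_add]
    simp [coeff_C, sumX_zero]
  simpa [coeff_C, sumX_zero] using h

theorem coeff_seriesBilin_C_right (β : ℕ → A →ₗ[R] A →ₗ[R] B) (a : A⟦X⟧) (g : A) (n : ℕ) :
    coeff n (seriesBilin β a (C g)) =
      ∑ p ∈ antidiagonal n, β p.1 (coeff p.2 a) g := by
  rw [coeff_seriesBilin]
  refine Finset.sum_congr rfl fun p _ => ?_
  rw [Finset.sum_eq_single (p.2, 0)]
  · simp
  · rintro ⟨i, j⟩ h1 h2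
    have : j ≠ 0 := by
      rintro rfl
      simp_all
    simp [coeff_C, this]
  · simp

theorem coeff_seriesBilin_C_left (β : ℕ → A →ₗ[R] A →ₗ[R] B) (f : A) (b : A⟦X⟧) (n : ℕ) :
    coeff n (seriesBilin β (C f) b) =
      ∑ p ∈ antidiagonal n, β p.1 f (coeff p.2 b) := by
  rw [coeff_seriesBilin]
  refine Finset.sum_congr rfl fun p _ => ?_
  rw [Finset.sum_eq_single (0, p.2)]
  · simp
  · rintro ⟨i, j⟩ h1 h2
    have : i ≠ 0 := by
      rintro rfl
      simp_all
    simp [coeff_C, this]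
  · simp

/-- On constants the identity is the hypothesis, coefficient by coefficient; `addHom_ext` then frees
the three arguments one at a time, starting with the last. -/
theorem seriesBilin_assoc (β : ℕ → A →ₗ[R] A →ₗ[R] A)
    (h : ∀ n f g k, ∑ p ∈ antidiagonal n, β p.1 (β p.2 f g) k =
      ∑ p ∈ antidiagonal n, β p.1 f (β p.2 g k)) (a b d : A⟦X⟧) :
    seriesBilin β (seriesBilin β a b) d = seriesBilin β a (seriesBilin β b d) := by
  have h3 : ∀ f g k, seriesBilin β (seriesBilin β (C f) (C g)) (C k) =
      seriesBilin β (C f) (seriesBilin β (C g) (C k)) := by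
    intro f g k
    ext n
    simpa [coeff_seriesBilin_C_right, coeff_seriesBilin_C_left, seriesBilin_C] using h n f g k
  have h2 : ∀ f g, seriesBilin β (seriesBilin β (C f) (C g)) d =
      seriesBilin β (C f) (seriesBilin β (C g) d) := fun f g =>
    addHom_ext (seriesBilin β (seriesBilin β (C f) (C g))).toAddMonoidHom
      ((seriesBilin β (C f)).comp (seriesBilin β (C g))).toAddMonoidHom
      (fun d => seriesBilin_X_mul_right β _ d)
      (fun d => by simp [seriesBilin_X_mul_right]) (h3 f g) d
  have h1 : ∀ f, seriesBilin β (seriesBilin β (C f) b) d =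
      seriesBilin β (C f) (seriesBilin β b d) := fun f =>
    addHom_ext (((seriesBilin β).flip d).comp (seriesBilin β (C f))).toAddMonoidHom
      ((seriesBilin β (C f)).comp ((seriesBilin β).flip d)).toAddMonoidHom
      (fun b => by simp [seriesBilin_X_mul_right, seriesBilin_X_mul_left])
      (fun b => by simp [seriesBilin_X_mul_right, seriesBilin_X_mul_left]) (h2 f) b
  exact addHom_ext (((seriesBilin β).flip d).comp ((seriesBilin β).flip b)).toAddMonoidHom
      ((seriesBilin β).flip (seriesBilin β b d)).toAddMonoidHom
      (fun b => by simp [seriesBilin_X_mul_left])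
      (fun b => by simp [seriesBilin_X_mul_left]) h1 a

end Series

/-! ### Smooth functions on the punctured space and their derivations -/

section Punctured

variable {q : ℕ}

/-- The punctured space `ℂ^{q+1} \ {0}`. -/
abbrev Punct (q : ℕ) : Type := {z : V q // z ≠ 0}

/-- Extension by zero of a function on the punctured space. -/
def ext (F : Punct q → ℂ) (z : V q) : ℂ :=
  open Classical in if hz : z ≠ 0 then F ⟨z, hz⟩ else 0

theorem ext_apply (F : Punct q → ℂ) (z : Punct q) : ext F z = F z := by
  simp [ext, z.2]

theorem contDiffOn_ext_iff (F : V q → ℂ) (F' : Punct q → ℂ) (h : ∀ z : Punct q, F' z = F z) :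
    ContDiffOn ℝ ∞ (ext F') {0}ᶜ ↔ ContDiffOn ℝ ∞ F {0}ᶜ :=
  contDiffOn_congr fun z hz => by rw [ext_apply F' ⟨z, hz⟩, h]

variable (q) in
/-- The subalgebra of smooth functions on the punctured space. -/
def SAlg : Subalgebra ℂ (Punct q → ℂ) where
  carrier := {F | ContDiffOn ℝ ∞ (ext F) {0}ᶜ}
  mul_mem' := fun {F G} hF hG =>
    (contDiffOn_ext_iff (ext F * ext G) _ fun z => by simp [ext_apply]).2 (hF.mul hG)
  add_mem' := fun {F G} hF hG =>
    (contDiffOn_ext_iff (ext F + ext G) _ fun z => by simp [ext_apply]).2 (hF.add hG)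
  algebraMap_mem' := fun c =>
    (contDiffOn_ext_iff (fun _ => c) _ fun z => rfl).2 contDiffOn_const

variable (q) in
/-- The algebra of smooth functions on the punctured space. -/
def S : Type := SAlg q

instance : CommRing (S q) := inferInstanceAs (CommRing (SAlg q))
instance : Algebra ℂ (S q) := inferInstanceAs (Algebra ℂ (SAlg q))

/-- The restriction of a function to the punctured space. -/
def toS (F : V q → ℂ) (h : ContDiffOn ℝ ∞ F {0}ᶜ) : S q :=
  ⟨fun z => F z, (contDiffOn_ext_iff F _ fun _ => rfl).2 h⟩

theorem toS_apply (F : V q → ℂ) (h : ContDiffOn ℝ ∞ F {0}ᶜ) (z : Punct q) :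
    (toS F h).1 z = F z := rfl

theorem S_ext {F G : S q} (h : ∀ z, F.1 z = G.1 z) : F = G :=
  Subtype.ext (funext h)

/-- Evaluation at a point of the punctured space. -/
def evalS (z : Punct q) : S q →ₐ[ℂ] ℂ := (Pi.evalAlgHom ℂ _ z).comp (SAlg q).val

theorem S_mul (F G : S q) : (F * G).1 = F.1 * G.1 := rfl
theorem S_add (F G : S q) : (F + G).1 = F.1 + G.1 := rfl
theorem S_sub (F G : S q) : (F - G).1 = F.1 - G.1 := rfl
theorem S_smul (c : ℂ) (F : S q) : (c • F).1 = c • F.1 := rfl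
theorem S_one : (1 : S q).1 = 1 := rfl
theorem S_zero : (0 : S q).1 = 0 := rfl
theorem S_pow (F : S q) (n : ℕ) : (F ^ n).1 = F.1 ^ n := rfl
theorem S_algebraMap (c : ℂ) : (algebraMap ℂ (S q) c).1 = fun _ => c := rfl

theorem S_sum_apply {ι : Type*} (s : Finset ι) (F : ι → S q) (z : Punct q) :
    (∑ i ∈ s, F i).1 z = ∑ i ∈ s, (F i).1 z :=
  map_sum (evalS z) F s

theorem S_contDiffOn (F : S q) : ContDiffOn ℝ ∞ (ext F.1) {0}ᶜ := F.2

theorem isOpen_punct : IsOpen ({0}ᶜ : Set (V q)) := isOpen_compl_singleton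

theorem S_contDiffAt (F : S q) (z : Punct q) : ContDiffAt ℝ ∞ (ext F.1) z :=
  (S_contDiffOn F).contDiffAt (isOpen_punct.mem_nhds z.2)

theorem S_differentiableAt (F : S q) (z : Punct q) : DifferentiableAt ℝ (ext F.1) z :=
  (S_contDiffAt F z).differentiableAt (by simp)

/-- The punctured space is open, so derivatives at its points do not see the value at the origin.
This makes extension by zero harmless. -/
theorem fderiv_congr_punct {F G : V q → ℂ} (h : ∀ z : Punct q, F z = G z) (z : Punct q) :
    fderiv ℝ F z = fderiv ℝ G z := by
  refine Filter.EventuallyEq.fderiv_eq ?_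
  filter_upwards [isOpen_punct.mem_nhds z.2] with y hy using h ⟨y, hy⟩

theorem contDiffOn_fderiv_apply {F : V q → ℂ} (h : ContDiffOn ℝ ∞ F {0}ᶜ) (v : V q) :
    ContDiffOn ℝ ∞ (fun z => fderiv ℝ F z v) {0}ᶜ :=
  (h.fderiv_of_isOpen isOpen_punct (by simp)).clm_apply contDiffOn_const

/-- The derivative in a fixed direction, as a derivation. -/
def Dir (v : V q) : Derivation ℂ (S q) (S q) :=
  Derivation.mk'
    { toFun := fun F => toS _ (contDiffOn_fderiv_apply (S_contDiffOn F) v)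
      map_add' := fun F G => S_ext fun z => by
        have h := fderiv_congr_punct (F := ext (F + G).1) (G := ext F.1 + ext G.1)
          (fun z => by simp [ext_apply, S_add]) z
        rw [fderiv_add (S_differentiableAt F z) (S_differentiableAt G z)] at h
        change fderiv ℝ (ext (F + G).1) z v = _
        rw [h]
        rfl
      map_smul' := fun c F => S_ext fun z => by
        have h := fderiv_congr_punct (F := ext (c • F).1) (G := c • ext F.1)
          (fun z => by simp [ext_apply, S_smul]) z
        rw [fderiv_const_smul (S_differentiableAt F z)] at h
        change fderiv ℝ (ext (c • F).1) z v = _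
        rw [h]
        rfl }
    fun F G => S_ext fun z => by
      have h := fderiv_congr_punct (F := ext (F * G).1) (G := ext F.1 * ext G.1)
        (fun z => by simp [ext_apply, S_mul]) z
      rw [fderiv_mul (S_differentiableAt F z) (S_differentiableAt G z)] at h
      change fderiv ℝ (ext (F * G).1) z v = _
      rw [h, ext_apply, ext_apply]
      rfl

theorem Dir_apply (v : V q) (F : S q) (z : Punct q) :
    (Dir v F).1 z = fderiv ℝ (ext F.1) z v := rfl

theorem Dir_apply_of_eq (v : V q) (F : V q → ℂ) (F' : S q) (h : ∀ z, F'.1 z = F z.1)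
    (z : Punct q) : (Dir v F').1 z = fderiv ℝ F z v := by
  rw [Dir_apply, fderiv_congr_punct fun z => (ext_apply _ z).trans (h z)]

/-- Symmetry of the second real derivative; commutation of all Wirtinger derivations reduces to it.
-/
theorem Dir_comm (v w : V q) (F : S q) : Dir v (Dir w F) = Dir w (Dir v F) := by
  refine S_ext fun z => ?_
  have h1 : DifferentiableAt ℝ (fderiv ℝ (ext F.1)) z :=
    ((S_contDiffAt F z).fderiv_right (m := 1) (by norm_cast)).differentiableAt (by simp)
  have h2 : ∀ v w, (Dir v (Dir w F)).1 z = fderiv ℝ (fderiv ℝ (ext F.1)) z v w := by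
    intro v w
    rw [Dir_apply_of_eq v (fun z => fderiv ℝ (ext F.1) z w) _ (fun z => rfl),
      fderiv_clm_apply h1 (by fun_prop)]
    simp
  rw [h2, h2]
  exact (S_contDiffAt F z).isSymmSndFDerivAt
    (by simp only [minSmoothness_of_isRCLikeNormedField]; norm_cast) v w

/-! ### Wirtinger derivations and coordinate functions -/

/-- The Wirtinger derivation `∂/∂z^A`. -/
def DZ (A : Fin (q + 1)) : Derivation ℂ (S q) (S q) :=
  (1 / 2 : ℂ) • (Dir (Pi.single A 1) - Complex.I • Dir (Pi.single A Complex.I))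

/-- The Wirtinger derivation `∂/∂z̄_A`. -/
def DB (A : Fin (q + 1)) : Derivation ℂ (S q) (S q) :=
  (1 / 2 : ℂ) • (Dir (Pi.single A 1) + Complex.I • Dir (Pi.single A Complex.I))

theorem DZ_eq_dz (A : Fin (q + 1)) (F : V q → ℂ) (F' : S q) (h : ∀ z, F'.1 z = F z.1)
    (z : Punct q) : (DZ A F').1 z = dz A F z := by
  simp [DZ, dz, S_sub, S_smul, Dir_apply_of_eq _ F F' h]

theorem DB_eq_dzbar (A : Fin (q + 1)) (F : V q → ℂ) (F' : S q) (h : ∀ z, F'.1 z = F z.1)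
    (z : Punct q) : (DB A F').1 z = dzbar A F z := by
  simp [DB, dzbar, S_add, S_smul, Dir_apply_of_eq _ F F' h, mul_add]

theorem DZ_DZ_comm (A B : Fin (q + 1)) (F : S q) : DZ A (DZ B F) = DZ B (DZ A F) := by
  simp only [DZ, Derivation.smul_apply, Derivation.sub_apply, Derivation.map_smul,
    Derivation.map_sub, Dir_comm (Pi.single B _)]
  module

theorem DB_DB_comm (A B : Fin (q + 1)) (F : S q) : DB A (DB B F) = DB B (DB A F) := by
  simp only [DB, Derivation.smul_apply, Derivation.add_apply, Derivation.map_smul,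
    Derivation.map_add, Dir_comm (Pi.single B _)]
  module

theorem DZ_DB_comm (A B : Fin (q + 1)) (F : S q) : DZ A (DB B F) = DB B (DZ A F) := by
  simp only [DZ, DB, Derivation.smul_apply, Derivation.add_apply, Derivation.sub_apply,
    Derivation.map_smul, Derivation.map_add, Derivation.map_sub, Dir_comm (Pi.single B _)]
  module

/-- The coordinate function `z^A`. -/
def zS (A : Fin (q + 1)) : S q :=
  toS (fun z => z A) (by fun_prop)

/-- The conjugate coordinate function `z̄_A`. -/
def zbS (A : Fin (q + 1)) : S q :=
  toS (fun z => (starRingEnd ℂ) (z A))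
    (Complex.conjCLE.contDiff.comp_contDiffOn (f := fun z : V q => z A) (by fun_prop))

theorem zS_apply (A : Fin (q + 1)) (z : Punct q) : (zS A).1 z = z.1 A := rfl

theorem zbS_apply (A : Fin (q + 1)) (z : Punct q) :
    (zbS A).1 z = (starRingEnd ℂ) (z.1 A) := rfl

theorem Dir_zS (v : V q) (A : Fin (q + 1)) : Dir v (zS A) = v A • 1 := by
  refine S_ext fun z => ?_
  rw [Dir_apply_of_eq v (fun z => z A) _ fun z => rfl]
  have : fderiv ℝ (fun z : V q => z A) z = ContinuousLinearMap.proj A :=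
    (ContinuousLinearMap.proj (R := ℝ) (φ := fun _ : Fin (q + 1) => ℂ) A).fderiv
  rw [this]
  simp [S_smul, S_one]

theorem Dir_zbS (v : V q) (A : Fin (q + 1)) :
    Dir v (zbS A) = (starRingEnd ℂ) (v A) • 1 := by
  refine S_ext fun z => ?_
  rw [Dir_apply_of_eq v (fun z => (starRingEnd ℂ) (z A)) _ fun z => rfl]
  have := ((Complex.conjCLE : ℂ →L[ℝ] ℂ).comp
    (ContinuousLinearMap.proj (R := ℝ) (φ := fun _ : Fin (q + 1) => ℂ) A)).fderiv (x := z.1)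
  refine (congrArg (fun L => L v) this).trans ?_
  simp [S_smul, S_one]

theorem DB_zS (A B : Fin (q + 1)) : DB A (zS B) = 0 := by
  simp only [DB, Derivation.smul_apply, Derivation.add_apply, Dir_zS]
  rw [smul_smul, ← add_smul, smul_smul]
  by_cases h : B = A <;> simp [h]

theorem DZ_zbS (A B : Fin (q + 1)) : DZ A (zbS B) = 0 := by
  simp only [DZ, Derivation.smul_apply, Derivation.sub_apply, Dir_zbS]
  rw [smul_smul, ← sub_smul, smul_smul]
  by_cases h : B = A <;> simp [h]

theorem DZ_zS (A B : Fin (q + 1)) : DZ A (zS B) = if B = A then 1 else 0 := by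
  simp only [DZ, Derivation.smul_apply, Derivation.sub_apply, Dir_zS]
  rw [smul_smul, ← sub_smul, smul_smul]
  by_cases h : B = A
  · simp [h]
    norm_num
  · simp [h]

theorem DB_zbS (A B : Fin (q + 1)) : DB A (zbS B) = if B = A then 1 else 0 := by
  simp only [DB, Derivation.smul_apply, Derivation.add_apply, Dir_zbS]
  rw [smul_smul, ← add_smul, smul_smul]
  by_cases h : B = A
  · simp [h]
    norm_num
  · simp [h]

/-- The function `x = ∑_A z^A z̄_A` on the punctured space. -/
def xS : S q := ∑ A, zS A * zbS A

theorem xS_apply (z : Punct q) : (xS : S q).1 z = (x z.1 : ℂ) := by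
  simp only [xS, S_sum_apply, x, Complex.ofReal_sum]
  refine Finset.sum_congr rfl fun A _ => ?_
  exact (Complex.mul_conj _).trans (by rw [Complex.normSq_eq_norm_sq]; rfl)

theorem DZ_xS (A : Fin (q + 1)) : DZ A xS = zbS A := by
  simp [xS, DZ_zS, DZ_zbS]

theorem DB_xS (A : Fin (q + 1)) : DB A xS = zS A := by
  simp [xS, DB_zS, DB_zbS]

theorem x_pos (z : Punct q) : 0 < x z.1 := by
  obtain ⟨A, hA⟩ := Function.ne_iff.1 z.2
  exact Finset.sum_pos' (fun _ _ => by positivity)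
    ⟨A, Finset.mem_univ A, by simpa [sq_pos_iff] using hA⟩

/-- The function `1 / x` on the punctured space. -/
def xinv : S q :=
  toS (fun z => (ext xS.1 z)⁻¹) ((S_contDiffOn xS).inv fun z hz => by
    rw [ext_apply _ ⟨z, hz⟩, xS_apply]
    exact_mod_cast (x_pos ⟨z, hz⟩).ne')

theorem xinv_apply (z : Punct q) : (xinv : S q).1 z = (x z.1 : ℂ)⁻¹ := by
  rw [xinv, toS_apply, ext_apply, xS_apply]

theorem xS_mul_xinv : (xS * xinv : S q) = 1 := by
  refine S_ext fun z => ?_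
  have := (x_pos z).ne'
  simp [S_mul, S_one, xS_apply, xinv_apply, this]

/-! ### Euler derivations -/

/-- The holomorphic Euler derivation `∑_A z^A ∂/∂z^A`. -/
def EZ : Derivation ℂ (S q) (S q) := ∑ A, zS A • DZ A

/-- The antiholomorphic Euler derivation `∑_A z̄_A ∂/∂z̄_A`. -/
def EB : Derivation ℂ (S q) (S q) := ∑ A, zbS A • DB A

theorem Derivation_sum_apply {ι : Type*} (s : Finset ι) (D : ι → Derivation ℂ (S q) (S q))
    (F : S q) : (∑ i ∈ s, D i) F = ∑ i ∈ s, D i F :=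
  map_sum (⟨⟨fun D => D F, rfl⟩, fun _ _ => rfl⟩ : Derivation ℂ (S q) (S q) →+ S q) D s

theorem EZ_eq (F : S q) : EZ F = ∑ A, zS A * DZ A F := by
  simp [EZ, Derivation_sum_apply]

theorem EB_eq (F : S q) : EB F = ∑ A, zbS A * DB A F := by
  simp [EB, Derivation_sum_apply]

theorem EZ_xS : EZ (xS : S q) = xS := by
  simp only [EZ_eq, DZ_xS]
  rfl

theorem EZ_xinv : EZ (xinv : S q) = -xinv := by
  rw [EZ.leibniz_of_mul_eq_one ((mul_comm _ _).trans xS_mul_xinv), EZ_xS, smul_eq_mul]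
  linear_combination (-xinv) * xS_mul_xinv (q := q)

/-- The real differential is `∑ (dz^A ∂_A + dz̄_A ∂̄_A)`, evaluated here on the vector with
components `c z^A`. -/
theorem fderiv_smul_self (F : S q) (z : Punct q) (c : ℂ) :
    fderiv ℝ (ext F.1) z (c • z.1) =
      c * (EZ F).1 z + (starRingEnd ℂ) c * (EB F).1 z := by
  have h1 : c • z.1 = ∑ A, (((c * z.1 A).re • (Pi.single A 1 : V q) +
      (c * z.1 A).im • (Pi.single A Complex.I : V q))) := by
    funext B
    simp [Finset.sum_apply, Pi.single_apply, Finset.sum_add_distrib, -Complex.mul_re,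
      -Complex.mul_im]
  rw [h1, map_sum, EZ_eq, EB_eq]
  simp only [S_sum_apply, Finset.mul_sum,
    ← Finset.sum_add_distrib]
  refine Finset.sum_congr rfl fun A _ => ?_
  have hr := Complex.re_eq_add_conj (c * z.1 A)
  have hi := Complex.im_eq_sub_conj (c * z.1 A)
  rw [map_add, map_smul, map_smul, Complex.real_smul, Complex.real_smul, hr, hi]
  simp only [DZ, DB, Derivation.smul_apply, Derivation.add_apply, Derivation.sub_apply,
    S_mul, S_smul, S_add, S_sub, Pi.mul_apply,
    Pi.smul_apply, Pi.add_apply, Pi.sub_apply, smul_eq_mul, Dir_apply, map_mul]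
  simp only [zS_apply, zbS_apply]
  field_simp
  ring_nf
  simp
  ring

/-- Differentiate at `t = 0` the constant function `t ↦ F (exp (t c) z)`. The choice `c = i` handles
`U(1)`-invariance, `c = 1` dilations. -/
theorem euler_of_invariant {F : S q} {c : ℂ}
    (h : ∀ (t : ℝ) (z w : Punct q), w.1 = Complex.exp (t * c) • z.1 → F.1 w = F.1 z) :
    c • EZ F + (starRingEnd ℂ) c • EB F = 0 := by
  refine S_ext fun z => ?_
  have h1 : HasDerivAt (fun t : ℝ => Complex.exp (t * c) • z.1) (c • z.1) 0 := by
    have := ((Complex.ofRealCLM.hasDerivAt (x := 0)).mul_const c).cexp.smul_const z.1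
    simpa using this
  have h0 : Complex.exp ((0 : ℝ) * c) • z.1 = z.1 := by simp
  have h2 : HasFDerivAt (ext F.1) (fderiv ℝ (ext F.1) z)
      ((fun t : ℝ => Complex.exp (t * c) • z.1) 0) := by
    simpa using (S_differentiableAt F z).hasFDerivAt
  have h3 := h2.comp_hasDerivAt (0 : ℝ) h1
  have h4 : (ext F.1 ∘ fun t : ℝ => Complex.exp (t * c) • z.1) = fun _ => F.1 z := by
    funext t
    have hw : Complex.exp (t * c) • z.1 ≠ 0 := smul_ne_zero (Complex.exp_ne_zero _) z.2
    rw [Function.comp_apply, ext_apply F.1 ⟨_, hw⟩]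
    exact h t z _ rfl
  rw [h4] at h3
  have h5 := h3.unique (hasDerivAt_const _ _)
  rw [fderiv_smul_self] at h5
  simpa [S_add, S_smul, S_zero] using h5

end Punctured

/-! ### The Wick product -/

section Wick

open TensorProduct Finset

theorem pow_apply_intertwine {R M N : Type*} [CommRing R] [AddCommGroup M] [AddCommGroup N]
    [Module R M] [Module R N] (f : M →ₗ[R] N) (a : Module.End R M) (b : Module.End R N)
    (h : ∀ t, b (f t) = f (a t)) (n : ℕ) (t : M) : (b ^ n) (f t) = f ((a ^ n) t) := by
  induction n generalizing t with
  | zero => simp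
  | succ n ih => rw [pow_succ, pow_succ, Module.End.mul_apply, Module.End.mul_apply, h, ih]

/-- The binomial theorem in the form `exp a · exp b = exp (a + b)`, one degree at a time. -/
theorem Commute.sum_pow_div_factorial {𝕜 M : Type*} [Field 𝕜] [CharZero 𝕜] [AddCommGroup M]
    [Module 𝕜 M] {a b : Module.End 𝕜 M} (h : Commute a b) (n : ℕ) :
    ∑ p ∈ antidiagonal n, ((p.1.factorial : 𝕜)⁻¹ * (p.2.factorial : 𝕜)⁻¹) • (a ^ p.1 * b ^ p.2) =
      (n.factorial : 𝕜)⁻¹ • (a + b) ^ n := by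
  rw [h.add_pow', Finset.smul_sum]
  refine Finset.sum_congr rfl fun p hp => ?_
  obtain rfl := Finset.HasAntidiagonal.mem_antidiagonal.1 hp
  rw [← Nat.cast_smul_eq_nsmul 𝕜, smul_smul, Nat.choose_symm_add, Nat.add_choose, Nat.cast_div
    (Nat.factorial_mul_factorial_dvd_factorial_add _ _)
    (by exact_mod_cast (Nat.mul_pos (Nat.factorial_pos _) (Nat.factorial_pos _)).ne')]
  congr 1
  have := Nat.factorial_ne_zero (p.1 + p.2)
  push_cast
  field_simp

variable {R ι A : Type*} [Field R] [Fintype ι] [CommRing A] [Algebra R A]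
  (D D' : ι → Derivation R A A)

theorem commute_tensorMap {R M N : Type*} [CommRing R] [AddCommGroup M] [AddCommGroup N]
    [Module R M] [Module R N] {f f' : Module.End R M} {g g' : Module.End R N}
    (hf : Commute f f') (hg : Commute g g') :
    Commute (TensorProduct.map f g : Module.End R (M ⊗[R] N)) (TensorProduct.map f' g') := by
  change _ * _ = _ * _
  rw [← TensorProduct.map_mul, ← TensorProduct.map_mul, hf.eq, hg.eq]

/-- The operator `∑_i D_i ⊗ D'_i`. -/
def K : Module.End R (A ⊗[R] A) := ∑ i, TensorProduct.map (D i).toLinearMap (D' i).toLinearMap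

/-- The bilinear map obtained from the `r`-th power of `∑_i D_i ⊗ D'_i` by multiplication. -/
def contr (r : ℕ) : A →ₗ[R] A →ₗ[R] A :=
  TensorProduct.curry (LinearMap.mul' R A ∘ₗ (K D D' ^ r))

theorem contr_eq (r : ℕ) (F G : A) :
    contr D D' r F G = LinearMap.mul' R A ((K D D' ^ r) (F ⊗ₜ G)) := rfl

/-- The operator `∑_i (D_i ⊗ 1 + 1 ⊗ D_i) ⊗ D'_i`. -/
def KL : Module.End R ((A ⊗[R] A) ⊗[R] A) :=
  ∑ i, TensorProduct.map (TensorProduct.map (D i).toLinearMap (1 : Module.End R A) +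
    TensorProduct.map (1 : Module.End R A) (D i).toLinearMap) (D' i).toLinearMap

/-- The operator `∑_i D_i ⊗ (D'_i ⊗ 1 + 1 ⊗ D'_i)`. -/
def KR : Module.End R (A ⊗[R] (A ⊗[R] A)) :=
  ∑ i, TensorProduct.map (D i).toLinearMap
    (TensorProduct.map (D' i).toLinearMap (1 : Module.End R A) +
      TensorProduct.map (1 : Module.End R A) (D' i).toLinearMap)

/-- The operator `K ⊗ 1`. -/
def K12 : Module.End R ((A ⊗[R] A) ⊗[R] A) :=
  TensorProduct.map (K D D') (1 : Module.End R A)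

/-- The operator `1 ⊗ K`. -/
def K23 : Module.End R (A ⊗[R] (A ⊗[R] A)) :=
  TensorProduct.map (1 : Module.End R A) (K D D')

/-- All derivations of two families commute with each other. -/
structure CommutingFamilies : Prop where
  left : ∀ i j, Commute (D i).toLinearMap (D j).toLinearMap
  right : ∀ i j, Commute (D' i).toLinearMap (D' j).toLinearMap
  mixed : ∀ i j, Commute (D i).toLinearMap (D' j).toLinearMap

variable {D D'}

theorem commute_KL_K12 (h : CommutingFamilies D D') : Commute (KL D D') (K12 D D') := by
  refine Commute.sum_left _ _ _ fun i _ => commute_tensorMap ?_ (Commute.one_right _)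
  refine Commute.sum_right _ _ _ fun j _ => Commute.add_left ?_ ?_
  · exact commute_tensorMap (h.left i j) (Commute.one_left _)
  · exact commute_tensorMap (Commute.one_left _) (h.mixed i j)

theorem commute_KR_K23 (h : CommutingFamilies D D') : Commute (KR D D') (K23 D D') := by
  refine Commute.sum_left _ _ _ fun i _ => commute_tensorMap (Commute.one_right _) ?_
  refine Commute.sum_right _ _ _ fun j _ => Commute.add_left ?_ ?_
  · exact commute_tensorMap (h.mixed j i).symm (Commute.one_left _)
  · exact commute_tensorMap (Commute.one_left _) (h.right i j)

/-- Both operators are the sum, over the three pairs of tensor slots, of `D_i` in the earlier slot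
and `D'_i` in the later one. -/
theorem assoc_KL_add_K12 (t : (A ⊗[R] A) ⊗[R] A) :
    TensorProduct.assoc R _ _ _ ((KL D D' + K12 D D') t) =
      (KR D D' + K23 D D') (TensorProduct.assoc R _ _ _ t) := by
  suffices h : (TensorProduct.assoc R A A A).toLinearMap ∘ₗ (KL D D' + K12 D D') =
      (KR D D' + K23 D D') ∘ₗ (TensorProduct.assoc R A A A).toLinearMap from
    LinearMap.congr_fun h t
  refine TensorProduct.ext_threefold fun F G H => ?_
  simp only [KL, K12, KR, K23, K, LinearMap.comp_apply, LinearMap.add_apply, LinearMap.sum_apply,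
    TensorProduct.map_tmul, LinearEquiv.coe_coe, TensorProduct.assoc_tmul, map_add, map_sum,
    TensorProduct.add_tmul, TensorProduct.tmul_add, TensorProduct.sum_tmul, TensorProduct.tmul_sum,
    Finset.sum_add_distrib, Module.End.one_apply]
  abel

/-- The Leibniz rule for the `D_i`: differentiating a product is differentiating either factor and
then multiplying. -/
theorem K_mul_left (t : (A ⊗[R] A) ⊗[R] A) :
    (K D D') (TensorProduct.map (LinearMap.mul' R A) LinearMap.id t) =
      TensorProduct.map (LinearMap.mul' R A) LinearMap.id (KL D D' t) := by
  suffices h : (K D D') ∘ₗ (TensorProduct.map (LinearMap.mul' R A) LinearMap.id) =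
      (TensorProduct.map (LinearMap.mul' R A) LinearMap.id) ∘ₗ KL D D' from
    LinearMap.congr_fun h t
  refine TensorProduct.ext_threefold fun F G H => ?_
  simp [KL, K, TensorProduct.add_tmul, mul_comm, add_comm]

/-- The Leibniz rule for the `D'_i`, checked on pure tensors after reassociating. -/
theorem K_mul_right (t : A ⊗[R] (A ⊗[R] A)) :
    (K D D') (TensorProduct.map LinearMap.id (LinearMap.mul' R A) t) =
      TensorProduct.map LinearMap.id (LinearMap.mul' R A) (KR D D' t) := by
  suffices h : (K D D') ∘ₗ (TensorProduct.map LinearMap.id (LinearMap.mul' R A)) ∘ₗ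
      (TensorProduct.assoc R A A A).toLinearMap =
      (TensorProduct.map LinearMap.id (LinearMap.mul' R A)) ∘ₗ KR D D' ∘ₗ
      (TensorProduct.assoc R A A A).toLinearMap by
    simpa using LinearMap.congr_fun h ((TensorProduct.assoc R A A A).symm t)
  refine TensorProduct.ext_threefold fun F G H => ?_
  simp [KR, K, TensorProduct.tmul_add, mul_comm, add_comm]

theorem K12_pow (n : ℕ) :
    (K12 D D' ^ n : Module.End R ((A ⊗[R] A) ⊗[R] A)) = TensorProduct.map (K D D' ^ n) 1 := by
  rw [K12, TensorProduct.map_pow, one_pow]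

theorem K23_pow (n : ℕ) :
    (K23 D D' ^ n : Module.End R (A ⊗[R] (A ⊗[R] A))) = TensorProduct.map 1 (K D D' ^ n) := by
  rw [K23, TensorProduct.map_pow, one_pow]

theorem contr_contr_left (r s : ℕ) (F G H : A) :
    contr D D' r (contr D D' s F G) H = LinearMap.mul' R A
      (TensorProduct.map (LinearMap.mul' R A) LinearMap.id
        ((KL D D' ^ r * K12 D D' ^ s) ((F ⊗ₜ G) ⊗ₜ H))) := by
  rw [Module.End.mul_apply, ← pow_apply_intertwine _ _ _ K_mul_left, K12_pow]
  rfl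

theorem contr_contr_right (r s : ℕ) (F G H : A) :
    contr D D' r F (contr D D' s G H) = LinearMap.mul' R A
      (TensorProduct.map LinearMap.id (LinearMap.mul' R A)
        ((KR D D' ^ r * K23 D D' ^ s) (F ⊗ₜ (G ⊗ₜ H)))) := by
  rw [Module.End.mul_apply, ← pow_apply_intertwine _ _ _ K_mul_right, K23_pow]
  rfl

theorem mul_mul_assoc (t : (A ⊗[R] A) ⊗[R] A) :
    LinearMap.mul' R A (TensorProduct.map LinearMap.id (LinearMap.mul' R A)
      (TensorProduct.assoc R _ _ _ t)) =
    LinearMap.mul' R A (TensorProduct.map (LinearMap.mul' R A) LinearMap.id t) := by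
  suffices h : LinearMap.mul' R A ∘ₗ
      (TensorProduct.map LinearMap.id (LinearMap.mul' R A)) ∘ₗ
      (TensorProduct.assoc R A A A).toLinearMap =
      LinearMap.mul' R A ∘ₗ TensorProduct.map (LinearMap.mul' R A) LinearMap.id from
    LinearMap.congr_fun h t
  refine TensorProduct.ext_threefold fun F G H => ?_
  simp [mul_assoc]

variable (D D') in
/-- The coefficients of the Wick product. -/
def wickCoeff (r : ℕ) : A →ₗ[R] A →ₗ[R] A := (r.factorial : R)⁻¹ • contr D D' r

theorem wickCoeff_apply (r : ℕ) (F G : A) :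
    wickCoeff D D' r F G = (r.factorial : R)⁻¹ • contr D D' r F G := rfl

/-- By the Leibniz rule the two bracketings are `exp (KL) exp (K12)` and `exp (KR) exp (K23)`
followed by multiplication. The factors commute, so the exponents add, and the two sums correspond
under reassociation. -/
theorem wickCoeff_assoc [CharZero R] (h : CommutingFamilies D D') (n : ℕ) (F G H : A) :
    ∑ p ∈ antidiagonal n, wickCoeff D D' p.1 (wickCoeff D D' p.2 F G) H =
      ∑ p ∈ antidiagonal n, wickCoeff D D' p.1 F (wickCoeff D D' p.2 G H) := by
  have h1 : ∑ p ∈ antidiagonal n, wickCoeff D D' p.1 (wickCoeff D D' p.2 F G) H =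
      LinearMap.mul' R A (TensorProduct.map (LinearMap.mul' R A) LinearMap.id
        (((n.factorial : R)⁻¹ • (KL D D' + K12 D D') ^ n) ((F ⊗ₜ G) ⊗ₜ H))) := by
    rw [← Commute.sum_pow_div_factorial (commute_KL_K12 h), LinearMap.sum_apply, map_sum, map_sum]
    refine Finset.sum_congr rfl fun p _ => ?_
    simp only [wickCoeff_apply, map_smul, LinearMap.smul_apply, contr_contr_left, smul_smul,
      mul_comm]
  have h2 : ∑ p ∈ antidiagonal n, wickCoeff D D' p.1 F (wickCoeff D D' p.2 G H) =
      LinearMap.mul' R A (TensorProduct.map LinearMap.id (LinearMap.mul' R A)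
        (((n.factorial : R)⁻¹ • (KR D D' + K23 D D') ^ n) (F ⊗ₜ (G ⊗ₜ H)))) := by
    rw [← Commute.sum_pow_div_factorial (commute_KR_K23 h), LinearMap.sum_apply, map_sum, map_sum]
    refine Finset.sum_congr rfl fun p _ => ?_
    simp only [wickCoeff_apply, map_smul, LinearMap.smul_apply, contr_contr_right, smul_smul,
      mul_comm]
  have h3 := pow_apply_intertwine (TensorProduct.assoc R A A A).toLinearMap
    (KL D D' + K12 D D') (KR D D' + K23 D D')
    (fun t => (assoc_KL_add_K12 t).symm) n ((F ⊗ₜ G) ⊗ₜ H)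
  rw [h1, h2, ← mul_mul_assoc]
  simp only [LinearMap.smul_apply, map_smul]
  congr 3
  exact h3.symm

theorem contr_zero (F G : A) : contr D D' 0 F G = F * G := by
  simp [contr_eq]

theorem contr_succ (r : ℕ) (F G : A) :
    contr D D' (r + 1) F G = ∑ i, contr D D' r (D i F) (D' i G) := by
  simp [contr_eq, pow_succ, K]

/-- The iterated derivative `D_{i_1} ⋯ D_{i_r} F`. -/
def iterD (D : ι → Derivation R A A) {r : ℕ} (i : Fin r → ι) (F : A) : A :=
  (List.ofFn i).foldr (fun j G => D j G) F

theorem iterD_cons {κ : Type*} (D : κ → Derivation R A A) {r : ℕ} (j : κ) (i : Fin r → κ)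
    (F : A) : iterD D (Fin.cons j i : Fin (r + 1) → κ) F = D j (iterD D i F) := by
  simp [iterD, List.ofFn_succ]

theorem sum_fin_cons {α β : Type*} [Fintype α] [AddCommMonoid β] (r : ℕ)
    (f : (Fin (r + 1) → α) → β) :
    ∑ i, f i = ∑ a, ∑ i : Fin r → α, f (Fin.cons a i) := by
  rw [← Fintype.sum_prod_type']
  exact (Fintype.sum_equiv (Fin.consEquiv fun _ => α) _ _ fun _ => rfl).symm

theorem K_pow_tmul (r : ℕ) (F G : A) :
    (K D D' ^ r) (F ⊗ₜ G) = ∑ i : Fin r → ι, iterD D i F ⊗ₜ[R] iterD D' i G := by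
  induction r with
  | zero => simp [iterD]
  | succ r ih =>
    rw [pow_succ', Module.End.mul_apply, ih, sum_fin_cons]
    simp only [iterD_cons, K, map_sum, LinearMap.sum_apply]
    rw [Finset.sum_comm]
    rfl

theorem contr_apply (r : ℕ) (F G : A) :
    contr D D' r F G = ∑ i : Fin r → ι, iterD D i F * iterD D' i G := by
  simp [contr_eq, K_pow_tmul]

/-- Each contraction contributes one factor from `D` and one from `D'`. It is used for dilations by
`u`, where these are `u` and `ū`. -/
theorem contr_semiconj (σ : A →ₐ[R] A) (c c' : R) (h : ∀ i F, D i (σ F) = c • σ (D i F))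
    (h' : ∀ i F, D' i (σ F) = c' • σ (D' i F)) (r : ℕ) (F G : A) :
    contr D D' r (σ F) (σ G) = (c * c') ^ r • σ (contr D D' r F G) := by
  induction r generalizing F G with
  | zero => simp [contr_zero]
  | succ r ih =>
    simp only [contr_succ, h, h', map_smul, LinearMap.smul_apply, ih, map_sum,
      Finset.smul_sum, smul_smul]
    refine Finset.sum_congr rfl fun A _ => ?_
    congr 1
    ring

/-- An endomorphism exchanging the two families reverses the arguments; complex conjugation is the
case in point. -/
theorem contr_swap (τ : A →+* A) (h : ∀ i F, D i (τ F) = τ (D' i F))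
    (h' : ∀ i F, D' i (τ F) = τ (D i F)) (r : ℕ) (F G : A) :
    τ (contr D D' r F G) = contr D D' r (τ G) (τ F) := by
  induction r generalizing F G with
  | zero => simp [contr_zero, mul_comm]
  | succ r ih => simp only [contr_succ, map_sum, ih, h, h']

/-! ### The Wick product on the punctured space -/

variable {q : ℕ}

theorem commutingFamilies_DZ_DB :
    CommutingFamilies (DZ : Fin (q + 1) → Derivation ℂ (S q) (S q)) DB where
  left A B := LinearMap.ext fun F => DZ_DZ_comm A B F
  right A B := LinearMap.ext fun F => DB_DB_comm A B F
  mixed A B := LinearMap.ext fun F => DZ_DB_comm A B F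

/-- The Wick product of formal power series of smooth functions on the punctured space. -/
def wickS : (S q)⟦X⟧ →ₗ[ℂ⟦X⟧] (S q)⟦X⟧ →ₗ[ℂ⟦X⟧] (S q)⟦X⟧ := seriesBilin (wickCoeff DZ DB)

theorem wickS_assoc (a b d : (S q)⟦X⟧) : wickS (wickS a b) d = wickS a (wickS b d) :=
  seriesBilin_assoc _ (wickCoeff_assoc commutingFamilies_DZ_DB) a b d

end Wick

/-! ### Scaling, conjugation and the star ideal -/

section Scaling

variable {q : ℕ}

/-- Multiplication of a point of the punctured space by a nonzero scalar. -/
def smulPunct (u : ℂˣ) (z : Punct q) : Punct q :=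
  ⟨(u : ℂ) • z.1, smul_ne_zero u.ne_zero z.2⟩

/-- Pullback along multiplication by a nonzero scalar. -/
def scale (u : ℂˣ) : S q →ₐ[ℂ] S q where
  toFun F := toS (fun z => ext F.1 ((u : ℂ) • z))
    ((S_contDiffOn F).comp (by fun_prop) fun z hz => smul_ne_zero u.ne_zero hz)
  map_one' := S_ext fun z => (ext_apply _ (smulPunct u z)).trans rfl
  map_mul' F G := S_ext fun z => (ext_apply _ (smulPunct u z)).trans
    (congrArg₂ (· * ·) (ext_apply _ (smulPunct u z)) (ext_apply _ (smulPunct u z))).symm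
  map_zero' := S_ext fun z => (ext_apply _ (smulPunct u z)).trans rfl
  map_add' F G := S_ext fun z => (ext_apply _ (smulPunct u z)).trans
    (congrArg₂ (· + ·) (ext_apply _ (smulPunct u z)) (ext_apply _ (smulPunct u z))).symm
  commutes' c := S_ext fun z => (ext_apply _ (smulPunct u z)).trans rfl

theorem scale_apply (u : ℂˣ) (F : S q) (z : Punct q) :
    (scale u F).1 z = F.1 (smulPunct u z) :=
  ext_apply _ (smulPunct u z)

theorem Dir_scale (u : ℂˣ) (F : S q) (v : V q) (z : Punct q) :
    (Dir v (scale u F)).1 z = fderiv ℝ (ext F.1) (smulPunct u z) ((u : ℂ) • v) := by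
  rw [Dir_apply_of_eq v (fun z => ext F.1 ((u : ℂ) • z)) _ fun z => rfl]
  have h1 : HasFDerivAt (fun z : V q => (u : ℂ) • z)
      ((u : ℂ) • ContinuousLinearMap.id ℝ (V q)) z.1 :=
    (hasFDerivAt_id (𝕜 := ℝ) z.1).const_smul (u : ℂ)
  have h2 := (S_differentiableAt F (smulPunct u z)).hasFDerivAt
  exact congrArg (fun L => L v) (h2.comp z.1 h1).fderiv

theorem smul_single_one (u : ℂ) (A : Fin (q + 1)) :
    u • (Pi.single A 1 : V q) =
      u.re • (Pi.single A 1 : V q) + u.im • (Pi.single A Complex.I : V q) := by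
  funext B
  by_cases h : B = A
  · subst h
    simp
  · simp [h]

theorem smul_single_I (u : ℂ) (A : Fin (q + 1)) :
    u • (Pi.single A Complex.I : V q) =
      (-u.im) • (Pi.single A 1 : V q) + u.re • (Pi.single A Complex.I : V q) := by
  funext B
  by_cases h : B = A
  · subst h
    apply Complex.ext <;> simp
  · simp [h]

theorem DZ_scale (u : ℂˣ) (F : S q) (A : Fin (q + 1)) :
    DZ A (scale u F) = (u : ℂ) • scale u (DZ A F) := by
  refine S_ext fun z => ?_
  simp only [DZ, Derivation.smul_apply, Derivation.sub_apply, map_smul, map_sub,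
    S_smul, S_sub, Pi.smul_apply, Pi.sub_apply, scale_apply, Dir_scale,
    smul_single_one, smul_single_I, map_add, smul_eq_mul, Complex.real_smul]
  simp only [Dir_apply]
  have hu := Complex.re_add_im (u : ℂ)
  set a := fderiv ℝ (ext F.1) (smulPunct u z) (Pi.single A 1)
  set b := fderiv ℝ (ext F.1) (smulPunct u z) (Pi.single A Complex.I)
  push_cast
  linear_combination ((1 / 2) * (a - Complex.I * b)) * hu +
    ((u : ℂ).im * b / 2) * Complex.I_sq

theorem DB_scale (u : ℂˣ) (F : S q) (A : Fin (q + 1)) :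
    DB A (scale u F) = (starRingEnd ℂ) (u : ℂ) • scale u (DB A F) := by
  refine S_ext fun z => ?_
  simp only [DB, Derivation.smul_apply, Derivation.add_apply, map_smul, map_add,
    S_smul, S_add, Pi.smul_apply, Pi.add_apply, scale_apply, Dir_scale,
    smul_single_one, smul_single_I, smul_eq_mul, Complex.real_smul]
  simp only [Dir_apply]
  have hu : (starRingEnd ℂ) (u : ℂ) = (u : ℂ).re - (u : ℂ).im * Complex.I := by
    apply Complex.ext <;> simp
  set a := fderiv ℝ (ext F.1) (smulPunct u z) (Pi.single A 1)
  set b := fderiv ℝ (ext F.1) (smulPunct u z) (Pi.single A Complex.I)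
  rw [hu]
  push_cast
  linear_combination ((u : ℂ).im * b / 2) * Complex.I_sq

theorem contr_scale (u : ℂˣ) (r : ℕ) (F G : S q) :
    contr DZ DB r (scale u F) (scale u G) =
      ((‖(u : ℂ)‖ : ℂ) ^ 2) ^ r • scale u (contr DZ DB r F G) := by
  have h := contr_semiconj (D := DZ) (D' := DB) (scale u) u ((starRingEnd ℂ) u)
    (fun A F => DZ_scale u F A) (fun A F => DB_scale u F A) r F G
  rw [h, Complex.mul_conj']

theorem scale_xS (u : ℂˣ) : scale u (xS : S q) = ((‖(u : ℂ)‖ : ℂ) ^ 2) • xS := by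
  refine S_ext fun z => ?_
  rw [scale_apply, xS_apply]
  change _ = _ * (xS : S q).1 z
  rw [xS_apply]
  simp [x, smulPunct, mul_pow, Finset.mul_sum]

/-! ### Complex conjugation -/

/-- Complex conjugation of smooth functions on the punctured space. -/
def conjS : S q →+* S q where
  toFun F := toS (fun z => (starRingEnd ℂ) (ext F.1 z))
    (Complex.conjCLE.contDiff.comp_contDiffOn (S_contDiffOn F))
  map_one' := S_ext fun z => by simp [toS_apply, ext_apply, S_one]
  map_mul' F G := S_ext fun z => by
    change (starRingEnd ℂ) (ext _ z.1) =
      (starRingEnd ℂ) (ext _ z.1) * (starRingEnd ℂ) (ext _ z.1)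
    simp [ext_apply, S_mul]
  map_zero' := S_ext fun z => by simp [toS_apply, ext_apply, S_zero]
  map_add' F G := S_ext fun z => by
    change (starRingEnd ℂ) (ext _ z.1) =
      (starRingEnd ℂ) (ext _ z.1) + (starRingEnd ℂ) (ext _ z.1)
    simp [ext_apply, S_add]

theorem conjS_apply (F : S q) (z : Punct q) : (conjS F).1 z = (starRingEnd ℂ) (F.1 z) := by
  change (starRingEnd ℂ) (ext F.1 z) = _
  rw [ext_apply]

theorem Dir_conjS (v : V q) (F : S q) : Dir v (conjS F) = conjS (Dir v F) := by
  refine S_ext fun z => ?_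
  rw [Dir_apply_of_eq v (fun z => (starRingEnd ℂ) (ext F.1 z)) _ fun z => rfl, conjS_apply,
    Dir_apply]
  have h := (Complex.conjCLE : ℂ →L[ℝ] ℂ).hasFDerivAt.comp z.1
    (S_differentiableAt F z).hasFDerivAt
  exact congrArg (fun L => L v) h.fderiv

theorem conjS_smul (c : ℂ) (F : S q) : conjS (c • F) = (starRingEnd ℂ) c • conjS F := by
  refine S_ext fun z => ?_
  simp [conjS_apply, S_smul]

theorem DZ_conjS (A : Fin (q + 1)) (F : S q) : DZ A (conjS F) = conjS (DB A F) := by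
  simp only [DZ, DB, Derivation.smul_apply, Derivation.add_apply, Derivation.sub_apply, Dir_conjS,
    conjS_smul, map_add]
  simp [sub_eq_add_neg, Complex.conj_ofNat]

theorem DB_conjS (A : Fin (q + 1)) (F : S q) : DB A (conjS F) = conjS (DZ A F) := by
  simp only [DZ, DB, Derivation.smul_apply, Derivation.add_apply, Derivation.sub_apply, Dir_conjS,
    conjS_smul, map_sub]
  simp [sub_eq_add_neg, Complex.conj_ofNat]

theorem conjS_contr (r : ℕ) (F G : S q) :
    conjS (contr DZ DB r F G) = contr DZ DB r (conjS G) (conjS F) := 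
  contr_swap conjS DZ_conjS DB_conjS r F G

theorem conjS_xS : conjS (xS : S q) = xS := by
  refine S_ext fun z => ?_
  simp [conjS_apply, xS_apply]

/-! ### Invariant and homogeneous functions -/

/-- The algebra of `U(1)`-invariant smooth functions on the punctured space. -/
def invAlg (q : ℕ) : Subalgebra ℂ (S q) where
  carrier := {F | ∀ u : ℂˣ, ‖(u : ℂ)‖ = 1 → scale u F = F}
  mul_mem' hF hG u hu := by rw [map_mul, hF u hu, hG u hu]
  add_mem' hF hG u hu := by rw [map_add, hF u hu, hG u hu]
  algebraMap_mem' c u _ := AlgHom.commutes _ c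

/-- The algebra of homogeneous smooth functions on the punctured space. -/
def homAlg (q : ℕ) : Subalgebra ℂ (S q) where
  carrier := {F | ∀ u : ℂˣ, scale u F = F}
  mul_mem' hF hG u := by rw [map_mul, hF u, hG u]
  add_mem' hF hG u := by rw [map_add, hF u, hG u]
  algebraMap_mem' c u := AlgHom.commutes _ c

theorem homAlg_le_invAlg : homAlg q ≤ invAlg q := fun _ hF u _ => hF u

theorem xS_mem_invAlg : (xS : S q) ∈ invAlg q := fun u hu => by
  rw [scale_xS, hu]
  simp

theorem xinv_mem_invAlg : (xinv : S q) ∈ invAlg q := fun u hu => by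
  have h := congrArg (scale u) (xS_mul_xinv (q := q))
  rw [map_mul, xS_mem_invAlg u hu, map_one] at h
  calc scale u xinv = xS * xinv * scale u xinv := by rw [xS_mul_xinv, one_mul]
    _ = xinv * (xS * scale u xinv) := by ring
    _ = xinv := by rw [h, mul_one]

theorem contr_mem_invAlg {F G : S q} (hF : F ∈ invAlg q) (hG : G ∈ invAlg q) (r : ℕ) :
    contr DZ DB r F G ∈ invAlg q := fun u hu => by
  have h := contr_scale u r F G
  rw [hF u hu, hG u hu, hu] at h
  simpa using h.symm

theorem scale_contr_of_mem_homAlg {F G : S q} (hF : F ∈ homAlg q) (hG : G ∈ homAlg q) (r : ℕ)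
    (u : ℂˣ) : contr DZ DB r F G = ((‖(u : ℂ)‖ : ℂ) ^ 2) ^ r • scale u (contr DZ DB r F G) := by
  have h := contr_scale u r F G
  rwa [hF u, hG u] at h

/-- The contraction scales by `‖u‖^{-2r}` and `x^r` by `‖u‖^{2r}`. -/
theorem xS_pow_mul_contr_mem_homAlg {F G : S q} (hF : F ∈ homAlg q) (hG : G ∈ homAlg q) (r : ℕ) :
    xS ^ r * contr DZ DB r F G ∈ homAlg q := fun u => by
  rw [map_mul, map_pow, scale_xS]
  conv_rhs => rw [scale_contr_of_mem_homAlg hF hG r u]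
  simp [smul_pow]

theorem EZ_eq_EB_of_mem_invAlg {F : S q} (hF : F ∈ invAlg q) : EZ F = EB F := by
  have h := euler_of_invariant (F := F) (c := Complex.I) fun t z w hw => by
    have h1 := congrArg (fun F : S q => F.1 z)
      (hF (Units.mk0 _ (Complex.exp_ne_zero (t * Complex.I)))
        (Complex.norm_exp_ofReal_mul_I t))
    rw [scale_apply] at h1
    rw [← h1]
    exact congrArg F.1 (Subtype.ext hw)
  have h2 : Complex.I • (EZ F - EB F) = 0 := by
    rw [smul_sub]
    simpa [sub_eq_add_neg] using h
  exact sub_eq_zero.1 ((smul_eq_zero.1 h2).resolve_left Complex.I_ne_zero)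

theorem EZ_eq_zero_of_mem_homAlg {F : S q} (hF : F ∈ homAlg q) : EZ F = 0 := by
  have h := euler_of_invariant (F := F) (c := 1) fun t z w hw => by
    have h1 := congrArg (fun F : S q => F.1 z)
      (hF (Units.mk0 _ (Complex.exp_ne_zero (t * 1))))
    rw [scale_apply] at h1
    rw [← h1]
    exact congrArg F.1 (Subtype.ext hw)
  rw [← EZ_eq_EB_of_mem_invAlg (homAlg_le_invAlg hF)] at h
  -- Invariance under positive dilations gives `EZ F + EB F = 0`, while `U(1)`-invariance gives `EZ
  -- F = EB F`.
  have h2 : (2 : ℂ) • EZ F = 0 := by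
    rw [two_smul]
    simpa using h
  exact (smul_eq_zero.1 h2).resolve_left two_ne_zero

end Scaling

/-! ### The star ideal of `x - μ` and its intersection with the homogeneous series -/

section StarIdeal

open PowerSeries Finset

/-- The formal power series with coefficients in a subalgebra. -/
def seriesIn {R A : Type*} [CommRing R] [CommRing A] [Algebra R A] (B : Subalgebra R A) :
    Submodule R⟦X⟧ A⟦X⟧ where
  carrier := {a | ∀ n, coeff n a ∈ B}
  add_mem' ha hb n := by
    rw [map_add]
    exact B.add_mem (ha n) (hb n)
  zero_mem' n := by
    rw [map_zero]
    exact B.zero_mem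
  smul_mem' c a ha n := by
    rw [series_smul_def, coeff_mul]
    refine B.sum_mem fun p _ => B.mul_mem ?_ (ha _)
    rw [coeff_map]
    exact B.algebraMap_mem _

variable {q : ℕ}

theorem C_mem_seriesIn {R A : Type*} [CommRing R] [CommRing A] [Algebra R A] {B : Subalgebra R A}
    {f : A} (hf : f ∈ B) : C f ∈ seriesIn B := fun n => by
  rw [coeff_C]
  split_ifs
  exacts [hf, B.zero_mem]

theorem sumX_mem_seriesIn {R A : Type*} [CommRing R] [CommRing A] [Algebra R A]
    {B : Subalgebra R A} {F : ℕ → A⟦X⟧} (hF : ∀ k, F k ∈ seriesIn B) :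
    sumX F ∈ seriesIn B := fun n => by
  rw [coeff_sumX]
  exact B.sum_mem fun p _ => hF _ _

/-- The function `x - μ` on the punctured space. -/
def xm (μ : ℂ) : S q := xS - algebraMap ℂ (S q) μ

theorem DZ_xm (μ : ℂ) (A : Fin (q + 1)) : DZ A (xm μ) = zbS A := by
  rw [xm, map_sub, DZ_xS, Derivation.map_algebraMap, sub_zero]

theorem DB_xm (μ : ℂ) (A : Fin (q + 1)) : DB A (xm μ) = zS A := by
  rw [xm, map_sub, DB_xS, Derivation.map_algebraMap, sub_zero]

theorem wickCoeff_zero (F G : S q) : wickCoeff DZ DB 0 F G = F * G := by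
  simp [wickCoeff_apply, contr_zero]

theorem wickCoeff_one_xm (μ : ℂ) (F : S q) : wickCoeff DZ DB 1 F (xm μ) = EZ F := by
  simp [wickCoeff_apply, contr_succ, contr_zero, DB_xm, EZ_eq, mul_comm]

theorem wickCoeff_xm_one (μ : ℂ) (F : S q) : wickCoeff DZ DB 1 (xm μ) F = EB F := by
  simp [wickCoeff_apply, contr_succ, contr_zero, DZ_xm, EB_eq]

/-- `x` is linear in `z̄`, so Wick multiplication by `x - μ` on the right stops after order one. -/
theorem wickCoeff_add_two_xm (μ : ℂ) (F : S q) (r : ℕ) :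
    wickCoeff DZ DB (r + 2) F (xm μ) = 0 := by
  simp [wickCoeff_apply, contr_succ, DB_xm, DB_zS]

theorem wickCoeff_xm_add_two (μ : ℂ) (F : S q) (r : ℕ) :
    wickCoeff DZ DB (r + 2) (xm μ) F = 0 := by
  simp [wickCoeff_apply, contr_succ, DZ_xm, DZ_zbS]

theorem coeff_zero_wickS_xm (μ : ℂ) (G : (S q)⟦X⟧) :
    coeff 0 (wickS G (C (xm μ))) = coeff 0 G * xm μ := by
  rw [wickS, coeff_seriesBilin_C_right]
  simp [wickCoeff_zero]

theorem coeff_succ_wickS_xm (μ : ℂ) (G : (S q)⟦X⟧) (n : ℕ) :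
    coeff (n + 1) (wickS G (C (xm μ))) = coeff (n + 1) G * xm μ + EZ (coeff n G) := by
  rw [wickS, coeff_seriesBilin_C_right, Finset.Nat.sum_antidiagonal_succ, wickCoeff_zero]
  congr 1
  cases n with
  | zero => simp [wickCoeff_one_xm]
  | succ n =>
    rw [Finset.Nat.sum_antidiagonal_succ]
    simp [wickCoeff_one_xm, wickCoeff_add_two_xm]

theorem coeff_succ_xm_wickS (μ : ℂ) (G : (S q)⟦X⟧) (n : ℕ) :
    coeff (n + 1) (wickS (C (xm μ)) G) = xm μ * coeff (n + 1) G + EB (coeff n G) := by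
  rw [wickS, coeff_seriesBilin_C_left, Finset.Nat.sum_antidiagonal_succ, wickCoeff_zero]
  congr 1
  cases n with
  | zero => simp [wickCoeff_xm_one]
  | succ n =>
    rw [Finset.Nat.sum_antidiagonal_succ]
    simp [wickCoeff_xm_one, wickCoeff_xm_add_two]

/-- The two products differ by `λ (EB - EZ) G`, which vanishes for invariant coefficients. -/
theorem wickS_xm_comm (μ : ℂ) {G : (S q)⟦X⟧} (hG : G ∈ seriesIn (invAlg q)) :
    wickS (C (xm μ)) G = wickS G (C (xm μ)) := by
  ext n
  cases n with
  | zero =>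
    rw [coeff_zero_wickS_xm, wickS, coeff_seriesBilin_C_left]
    simp [wickCoeff_zero, mul_comm]
  | succ n =>
    rw [coeff_succ_xm_wickS, coeff_succ_wickS_xm, EZ_eq_EB_of_mem_invAlg (hG n), mul_comm]

theorem wickS_mem_seriesIn {F G : (S q)⟦X⟧} (hF : F ∈ seriesIn (invAlg q))
    (hG : G ∈ seriesIn (invAlg q)) : wickS F G ∈ seriesIn (invAlg q) := fun n => by
  rw [wickS, coeff_seriesBilin]
  refine (invAlg q).sum_mem fun p _ => (invAlg q).sum_mem fun s _ => ?_
  rw [wickCoeff_apply]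
  exact (invAlg q).smul_mem (contr_mem_invAlg (hF _) (hG _) _) _

variable (q) in
/-- The star ideal generated by `x - μ`. -/
def starJ (μ : ℂ) : Submodule ℂ⟦X⟧ (S q)⟦X⟧ :=
  (seriesIn (invAlg q)).map (wickS.flip (C (xm μ)))

theorem mem_starJ {μ : ℂ} {a : (S q)⟦X⟧} :
    a ∈ starJ q μ ↔ ∃ G ∈ seriesIn (invAlg q), wickS G (C (xm μ)) = a := Iff.rfl

theorem sumX_mem_starJ {μ : ℂ} {F : ℕ → (S q)⟦X⟧} (hF : ∀ k, F k ∈ starJ q μ) :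
    sumX F ∈ starJ q μ := by
  choose G hG hGF using hF
  refine ⟨sumX G, sumX_mem_seriesIn hG, ?_⟩
  have := map_sumX (wickS.flip (C (xm μ))).toAddMonoidHom
    (fun a => seriesBilin_X_mul_left _ a _) G
  refine this.trans ?_
  congr 1
  funext k
  exact hGF k

theorem wickS_mem_starJ_right {μ : ℂ} {F a : (S q)⟦X⟧} (hF : F ∈ seriesIn (invAlg q))
    (ha : a ∈ starJ q μ) : wickS F a ∈ starJ q μ := by
  obtain ⟨G, hG, rfl⟩ := mem_starJ.1 ha
  rw [← wickS_assoc]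
  exact ⟨_, wickS_mem_seriesIn hF hG, rfl⟩

/-- The ideal is defined with `x - μ` on the right; centrality moves it past the invariant factor
`F`. -/
theorem wickS_mem_starJ_left {μ : ℂ} {F a : (S q)⟦X⟧} (hF : F ∈ seriesIn (invAlg q))
    (ha : a ∈ starJ q μ) : wickS a F ∈ starJ q μ := by
  obtain ⟨G, hG, rfl⟩ := mem_starJ.1 ha
  rw [wickS_assoc, wickS_xm_comm μ hF, ← wickS_assoc]
  exact ⟨_, wickS_mem_seriesIn hG hF, rfl⟩

theorem xm_apply (μ : ℝ) (z : Punct q) : (xm (μ : ℂ) : S q).1 z = ((x z.1 - μ : ℝ) : ℂ) := by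
  rw [xm, S_sub, Pi.sub_apply, xS_apply, S_algebraMap]
  push_cast
  rfl

/-- Every point of the punctured space is a positive multiple of a point with `x = μ`. -/
theorem exists_smul_level {μ : ℝ} (hμ : 0 < μ) (z : Punct q) :
    ∃ u : ℂˣ, x (smulPunct u z).1 = μ := by
  have hx := x_pos z
  have h : (Real.sqrt μ / Real.sqrt (x z.1) : ℝ) ≠ 0 :=
    (div_pos (Real.sqrt_pos.2 hμ) (Real.sqrt_pos.2 hx)).ne'
  refine ⟨Units.mk0 ((Real.sqrt μ / Real.sqrt (x z.1) : ℝ) : ℂ) (by exact_mod_cast h), ?_⟩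
  have h1 : ∀ a : ℝ, x ((a : ℂ) • z.1) = a ^ 2 * x z.1 := fun a => by
    simp [x, mul_pow, Finset.mul_sum]
  change x (((Real.sqrt μ / Real.sqrt (x z.1) : ℝ) : ℂ) • z.1) = μ
  rw [h1, div_pow, Real.sq_sqrt hμ.le, Real.sq_sqrt hx.le]
  field_simp

/-- The product vanishes on the level set `x = μ`, which meets every orbit of the scalars. -/
theorem eq_zero_of_mul_xm_mem_homAlg {μ : ℝ} (hμ : 0 < μ) {G : S q}
    (h : G * xm (μ : ℂ) ∈ homAlg q) : G * xm (μ : ℂ) = 0 := by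
  refine S_ext fun z => ?_
  obtain ⟨u, hu⟩ := exists_smul_level hμ z
  rw [← h u, scale_apply, S_mul, Pi.mul_apply, xm_apply, hu]
  simp [S_zero]

/-- `G` vanishes off the level set. Each ray meets that set in isolated points, so continuity along
the ray through `z` gives `G z = 0` also on it. -/
theorem eq_zero_of_mul_xm_eq_zero {μ : ℝ} {G : S q} (h : G * xm (μ : ℂ) = 0) : G = 0 := by
  refine S_ext fun z => ?_
  rw [S_zero, Pi.zero_apply, ← ext_apply G.1 z]
  have hx := x_pos z
  have hc : ContinuousAt (fun t : ℝ => ext G.1 ((t : ℂ) • z.1)) 1 := by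
    refine ContinuousAt.comp (g := ext G.1) ?_ (by fun_prop)
    simpa using (S_contDiffAt G z).continuousAt
  have hev : ∀ᶠ t : ℝ in nhdsWithin 1 {1}ᶜ, ext G.1 ((t : ℂ) • z.1) = 0 := by
    -- The parameter `1` is removed because `z` itself may lie on the level set; the finitely many
    -- others stay away from `1`.
    have hfin : ({t : ℝ | t ^ 2 * x z.1 = μ} \ {1}).Finite := by
      refine Set.Finite.subset (Set.toFinite {Real.sqrt (μ / x z.1), -Real.sqrt (μ / x z.1)}) ?_
      rintro t ⟨ht, -⟩
      have : t ^ 2 = μ / x z.1 := by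
        rw [eq_div_iff hx.ne']
        exact ht
      rw [← this, Real.sqrt_sq_eq_abs]
      rcases abs_choice t with h | h <;> simp [h]
    have h1 : ∀ᶠ t : ℝ in nhdsWithin 1 {1}ᶜ, t ∉ {t : ℝ | t ^ 2 * x z.1 = μ} \ {1} :=
      mem_nhdsWithin_of_mem_nhds (hfin.isClosed.isOpen_compl.mem_nhds (by simp))
    have h2 : ∀ᶠ t : ℝ in nhdsWithin 1 {1}ᶜ, t ≠ 0 :=
      mem_nhdsWithin_of_mem_nhds (isOpen_ne.mem_nhds one_ne_zero)
    filter_upwards [h1, h2, self_mem_nhdsWithin] with t h1 h2 h3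
    have h4 : t ^ 2 * x z.1 ≠ μ := fun h => h1 ⟨h, h3⟩
    let w : Punct q := smulPunct (Units.mk0 (t : ℂ) (by exact_mod_cast h2)) z
    have h5 : (G * xm (μ : ℂ)).1 w = 0 := by
      rw [h]
      rfl
    have h6 : x w.1 = t ^ 2 * x z.1 := by
      simp [w, smulPunct, x, mul_pow, Finset.mul_sum]
    rw [S_mul, Pi.mul_apply, xm_apply, h6, mul_eq_zero] at h5
    exact (ext_apply G.1 w).trans (h5.resolve_right (by exact_mod_cast sub_ne_zero.2 h4))
  have h7 := tendsto_nhds_unique (hc.tendsto.mono_left nhdsWithin_le_nhds)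
    (tendsto_const_nhds.congr' (hev.mono fun _ h => h.symm))
  simpa using h7

/-- Order by order: once the coefficient of `G` in order `n` is zero, its Euler term disappears from
order `n + 1`, leaving a homogeneous multiple of `x - μ`, which must vanish. -/
theorem eq_zero_of_mem_starJ {μ : ℝ} (hμ : 0 < μ) {a : (S q)⟦X⟧} (ha : a ∈ starJ q μ)
    (hh : a ∈ seriesIn (homAlg q)) : a = 0 := by
  obtain ⟨G, hG, rfl⟩ := mem_starJ.1 ha
  have hG0 : ∀ n, coeff n G = 0 := by
    intro n
    induction n with
    | zero =>
      have h := hh 0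
      rw [coeff_zero_wickS_xm] at h
      exact eq_zero_of_mul_xm_eq_zero (eq_zero_of_mul_xm_mem_homAlg hμ h)
    | succ n ih =>
      have h := hh (n + 1)
      rw [coeff_succ_wickS_xm, ih, map_zero, add_zero] at h
      exact eq_zero_of_mul_xm_eq_zero (eq_zero_of_mul_xm_mem_homAlg hμ h)
  have : G = 0 := by
    ext n
    rw [hG0, map_zero]
  simp [this]

/-! ### Reduction of powers of `1 / x` -/

/-- The formal power series `μ + k λ`. -/
def den (μ : ℂ) (k : ℕ) : ℂ⟦X⟧ := C μ + (k : ℂ⟦X⟧) * X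

/-- The formal power series `1 / ((μ + λ) ⋯ (μ + r λ))`. -/
def denProd (μ : ℂ) (r : ℕ) : ℂ⟦X⟧ := ∏ k ∈ range r, (den μ (k + 1))⁻¹

theorem den_mul_inv {μ : ℂ} (hμ : μ ≠ 0) (k : ℕ) : den μ k * (den μ k)⁻¹ = 1 :=
  PowerSeries.mul_inv_cancel _ (by simpa [den] using hμ)

theorem den_smul_C {A : Type*} [CommRing A] [Algebra ℂ A] (μ : ℂ) (k : ℕ) (f : A) :
    den μ k • C f = C (μ • f) + X * C ((k : ℂ) • f) := by
  rw [series_smul_def, den, Algebra.smul_def, Algebra.smul_def]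
  simp only [map_add, map_mul, map_C, PowerSeries.map_X, map_natCast]
  ring

theorem xinv_pow_step (μ : ℂ) {H : S q} (hH : H ∈ homAlg q) (r : ℕ) :
    C (H * xinv ^ r) - den μ (r + 1) • C (H * xinv ^ (r + 1)) ∈ starJ q μ := by
  -- With `P = H x^{-(r+1)}` as multiplier, the product is `P (x - μ) + λ EZ P`; its pointwise part
  -- starts with `H x^{-r}`, and `EZ P` is a multiple of `P`.
  refine mem_starJ.2 ⟨C (H * xinv ^ (r + 1)), C_mem_seriesIn
    ((invAlg q).mul_mem (homAlg_le_invAlg hH)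
    ((invAlg q).pow_mem xinv_mem_invAlg _)), ?_⟩
  have hE : EZ (H * xinv ^ (r + 1)) = -((r : ℂ) + 1) • (H * xinv ^ (r + 1)) := by
    rw [Derivation.leibniz, EZ_eq_zero_of_mem_homAlg hH, Derivation.leibniz_pow, EZ_xinv]
    simp only [smul_eq_mul, nsmul_eq_mul]
    simp only [Algebra.smul_def, map_neg, map_add, map_natCast, map_one]
    push_cast
    ring
  have h0 : H * xinv ^ (r + 1) * xm μ = H * xinv ^ r - μ • (H * xinv ^ (r + 1)) := by
    rw [xm, Algebra.smul_def]
    linear_combination (H * xinv ^ r) * xS_mul_xinv (q := q)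
  generalize H * xinv ^ (r + 1) = P at hE h0 ⊢
  generalize H * xinv ^ r = Q at h0 ⊢
  ext n
  rw [den_smul_C, map_sub, map_add]
  cases n with
  | zero =>
    rw [coeff_zero_wickS_xm]
    simp [h0]
  | succ n =>
    rw [coeff_succ_wickS_xm, coeff_succ_X_mul]
    cases n with
    | zero =>
      simp [coeff_C, hE]
      module
    | succ n => simp

/-- Iterate `xinv_pow_step`, dividing each time by `μ + (r+1)λ`, a unit because `μ ≠ 0`. -/
theorem xinv_pow_reduce {μ : ℂ} (hμ : μ ≠ 0) {H : S q} (hH : H ∈ homAlg q) (r : ℕ) :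
    C (H * xinv ^ r) - denProd μ r • C H ∈ starJ q μ := by
  induction r with
  | zero => simp [denProd]
  | succ r ih =>
    have h := (starJ q μ).smul_mem ((den μ (r + 1))⁻¹)
      ((starJ q μ).sub_mem ih (xinv_pow_step μ hH r))
    rw [sub_sub_sub_cancel_left, smul_sub, smul_smul, smul_smul,
      mul_comm (den μ (r + 1))⁻¹ (den μ (r + 1)), den_mul_inv hμ, one_smul] at h
    rw [denProd, prod_range_succ, mul_comm _ (den μ (r + 1))⁻¹]
    exact h

/-- The formal power series `1 / (r! [c]_r)`. -/
def weightS (μ : ℂ) (r : ℕ) : ℂ⟦X⟧ := X ^ r * (C (r.factorial : ℂ)⁻¹ * denProd μ r)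

theorem coeff_weightS_of_lt (μ : ℂ) {r n : ℕ} (h : n < r) : coeff n (weightS μ r) = 0 := by
  rw [weightS, coeff_X_pow_mul', if_neg (by omega)]

/-- The homogeneous part of the Wick product of homogeneous functions. -/
theorem wickS_sub_mem_starJ {μ : ℂ} (hμ : μ ≠ 0) {F G : S q} (hF : F ∈ homAlg q)
    (hG : G ∈ homAlg q) :
    wickS (C F) (C G) - PowerSeries.mk (fun n => ∑ r ∈ range (n + 1),
      coeff n (weightS μ r) • (xS ^ r * contr DZ DB r F G)) ∈ starJ q μ := by
  have h1 : wickS (C F) (C G) = sumX fun r => C (wickCoeff DZ DB r F G) := by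
    rw [sumX_C, wickS, seriesBilin_C]
  -- The weight has the factor `X ^ r`, which `sumX` supplies; the claim then splits into one
  -- congruence for each `r`.
  have h2 : (PowerSeries.mk fun n => ∑ r ∈ range (n + 1),
      coeff n (weightS μ r) • (xS ^ r * contr DZ DB r F G)) = sumX fun r =>
        (C (r.factorial : ℂ)⁻¹ * denProd μ r) • C (xS ^ r * contr DZ DB r F G) := by
    ext n
    rw [coeff_mk, coeff_sumX, Finset.Nat.sum_antidiagonal_eq_sum_range_succ_mk]
    refine Finset.sum_congr rfl fun r hr => ?_
    have hr' : r ≤ n := Nat.lt_succ_iff.1 (mem_range.1 hr)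
    rw [weightS, coeff_X_pow_mul', if_pos hr', series_smul_def, coeff_mul_C, coeff_map,
      Algebra.smul_def]
  rw [h1, h2, ← sumX_sub]
  refine sumX_mem_starJ fun r => ?_
  have h3 := (starJ q μ).smul_mem (C (r.factorial : ℂ)⁻¹)
    (xinv_pow_reduce hμ (xS_pow_mul_contr_mem_homAlg hF hG r) r)
  -- The contraction is a homogeneous function times `x^{-r}`, the form that `xinv_pow_reduce`
  -- accepts.
  have h4 : xS ^ r * contr DZ DB r F G * xinv ^ r = contr DZ DB r F G := by
    rw [mul_right_comm, ← mul_pow, xS_mul_xinv, one_pow, one_mul]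
  rw [h4, smul_sub, smul_smul] at h3
  have h5 : C (wickCoeff DZ DB r F G) =
      (C (r.factorial : ℂ)⁻¹ : ℂ⟦X⟧) • C (contr DZ DB r F G) := by
    rw [series_smul_def, map_C, ← map_mul, wickCoeff_apply, Algebra.smul_def]
  rw [h5]
  exact h3

end StarIdeal

/-! ### Functions on projective space -/

section Descent

variable {q : ℕ}

/-- The `i`-th affine chart. -/
def chart (i : Fin (q + 1)) (z : V q) : Fin q → ℂ := fun j => z (i.succAbove j) / z i

theorem insertNth_chart (i : Fin (q + 1)) (z : V q) (hz : z i ≠ 0) :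
    (i.insertNth (1 : ℂ) (chart i z) : V q) = (z i)⁻¹ • z := by
  funext j
  refine Fin.succAboveCases i ?_ (fun k => ?_) j
  · simp [hz]
  · simp [chart, div_eq_inv_mul]

theorem chart_insertNth (i : Fin (q + 1)) (w : Fin q → ℂ) :
    chart i (i.insertNth (1 : ℂ) w : V q) = w := by
  funext j
  simp [chart]

theorem affine_chart (i : Fin (q + 1)) (z : V q) (hz : z ≠ 0) (hi : z i ≠ 0) :
    affine i (chart i z) = Projectivization.mk ℂ z hz := by
  rw [affine, Projectivization.mk_eq_mk_iff']
  exact ⟨(z i)⁻¹, (insertNth_chart i z hi).symm⟩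

theorem pullback_apply (f : Smooth q) (z : V q) (hz : z ≠ 0) :
    pullback f z = f.1 (Projectivization.mk ℂ z hz) := by
  simp [pullback, hz]

theorem pullback_eq_chart (f : Smooth q) (i : Fin (q + 1)) (z : V q) (hi : z i ≠ 0) :
    pullback f z = f.1 (affine i (chart i z)) := by
  have hz : z ≠ 0 := fun h => hi (by simp [h])
  rw [affine_chart i z hz hi, pullback_apply]

theorem isOpen_chart (i : Fin (q + 1)) : IsOpen {z : V q | z i ≠ 0} :=
  isOpen_ne_fun (by fun_prop) (by fun_prop)

theorem contDiffOn_chart (i : Fin (q + 1)) : ContDiffOn ℝ ∞ (chart i) {z : V q | z i ≠ 0} := by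
  rw [contDiffOn_pi]
  intro j
  have h1 : ContDiff ℝ ∞ fun z : V q => z (i.succAbove j) := by fun_prop
  have h2 : ContDiff ℝ ∞ fun z : V q => z i := by fun_prop
  simp only [chart, div_eq_mul_inv]
  exact h1.contDiffOn.mul (h2.contDiffOn.inv fun z hz => hz)

/-- Near a point with `z_i ≠ 0` the pullback factors through the `i`-th chart. -/
theorem contDiffOn_pullback (f : Smooth q) : ContDiffOn ℝ ∞ (pullback f) {0}ᶜ := by
  intro z hz
  obtain ⟨i, hi⟩ := Function.ne_iff.1 (show z ≠ 0 from hz)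
  have h1 : ContDiffAt ℝ ∞ ((fun w => f.1 (affine i w)) ∘ chart i) z :=
    (f.2 i).contDiffAt.comp z ((contDiffOn_chart i).contDiffAt ((isOpen_chart i).mem_nhds hi))
  refine (h1.congr_of_eventuallyEq ?_).contDiffWithinAt
  filter_upwards [(isOpen_chart i).mem_nhds hi] with y hy using pullback_eq_chart f i y hy

/-- The pullback along the projection to `CP^q`. -/
def pb : Smooth q →ₐ[ℂ] S q where
  toFun f := toS (pullback f) (contDiffOn_pullback f)
  map_one' := S_ext fun z => pullback_apply _ z.1 z.2
  map_mul' f g := S_ext fun z => by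
    rw [S_mul, Pi.mul_apply, toS_apply, toS_apply, toS_apply, pullback_apply _ z.1 z.2,
      pullback_apply _ z.1 z.2, pullback_apply _ z.1 z.2]
    rfl
  map_zero' := S_ext fun z => pullback_apply _ z.1 z.2
  map_add' f g := S_ext fun z => by
    rw [S_add, Pi.add_apply, toS_apply, toS_apply, toS_apply, pullback_apply _ z.1 z.2,
      pullback_apply _ z.1 z.2, pullback_apply _ z.1 z.2]
    rfl
  commutes' c := S_ext fun z => pullback_apply _ z.1 z.2

theorem pb_apply (f : Smooth q) (z : Punct q) : (pb f).1 z = pullback f z.1 := rfl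

theorem pb_apply_mk (f : Smooth q) (z : Punct q) :
    (pb f).1 z = f.1 (Projectivization.mk ℂ z.1 z.2) := pullback_apply f z.1 z.2

theorem pb_injective : Function.Injective (pb : Smooth q → S q) := fun f g h => by
  refine Subtype.ext (funext fun p => ?_)
  induction p using Projectivization.ind with
  | h z hz =>
    rw [← pb_apply_mk f ⟨z, hz⟩, h, pb_apply_mk]

theorem pb_mem_homAlg (f : Smooth q) : pb f ∈ homAlg q := fun u => by
  refine S_ext fun z => ?_
  rw [scale_apply, pb_apply_mk, pb_apply_mk]
  refine congrArg f.1 ?_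
  rw [Projectivization.mk_eq_mk_iff']
  exact ⟨u, rfl⟩

theorem contDiff_insertNth (i : Fin (q + 1)) :
    ContDiff ℝ ∞ fun w : Fin q → ℂ => (i.insertNth (1 : ℂ) w : V q) := by
  rw [contDiff_pi]
  intro j
  refine Fin.succAboveCases i ?_ (fun k => ?_) j
  · simpa using contDiff_const
  · simpa using contDiff_apply ℝ ℂ k

/-- A homogeneous function is constant on the fibres of `π`, so it may be evaluated at any
representative. For smoothness in a chart, the chosen `rep` is replaced by the smooth section with
`z_i = 1`. -/
theorem exists_pb_eq {F : S q} (hF : F ∈ homAlg q) : ∃ f : Smooth q, pb f = F := by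
  have h : ∀ (z : V q) (hz : z ≠ 0),
      F.1 ⟨(Projectivization.mk ℂ z hz).rep, (Projectivization.mk ℂ z hz).rep_nonzero⟩ =
        F.1 ⟨z, hz⟩ := by
    intro z hz
    obtain ⟨u, hu⟩ := Projectivization.exists_smul_eq_mk_rep ℂ z hz
    have h1 := congrArg (fun F : S q => F.1 ⟨z, hz⟩) (hF u)
    rw [scale_apply] at h1
    rw [← h1]
    exact congrArg F.1 (Subtype.ext hu.symm)
  refine ⟨⟨fun p => F.1 ⟨p.rep, p.rep_nonzero⟩, fun i => ?_⟩, S_ext fun z => ?_⟩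
  · have h2 := (S_contDiffOn F).comp_contDiff (contDiff_insertNth i)
      fun w => insertNth_one_ne_zero i w
    have h3 : (fun w : Fin q → ℂ => F.1 ⟨(affine i w).rep, (affine i w).rep_nonzero⟩) =
        ext F.1 ∘ fun w => (i.insertNth (1 : ℂ) w : V q) := funext fun w =>
      (h _ (insertNth_one_ne_zero i w)).trans
        (ext_apply F.1 ⟨_, insertNth_one_ne_zero i w⟩).symm
    exact h3 ▸ h2
  · rw [pb_apply_mk]
    exact h z.1 z.2

/-- The function on `CP^q` whose pullback is `M_r(π^* f, π^* g)`. -/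
def MFun (r : ℕ) (f g : Smooth q) : Smooth q :=
  (exists_pb_eq (xS_pow_mul_contr_mem_homAlg (pb_mem_homAlg f) (pb_mem_homAlg g) r)).choose

theorem pb_MFun (r : ℕ) (f g : Smooth q) :
    pb (MFun r f g) = xS ^ r * contr DZ DB r (pb f) (pb g) :=
  (exists_pb_eq (xS_pow_mul_contr_mem_homAlg (pb_mem_homAlg f) (pb_mem_homAlg g) r)).choose_spec

/-- The operator `M_r` on `CP^q`. -/
def Mop (r : ℕ) : Smooth q →ₗ[ℂ] Smooth q →ₗ[ℂ] Smooth q :=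
  LinearMap.mk₂ ℂ (MFun r)
    (fun f f' g => pb_injective (by simp only [pb_MFun, map_add, LinearMap.add_apply, mul_add]))
    (fun c f g => pb_injective (by
      simp only [pb_MFun, map_smul, LinearMap.smul_apply, mul_smul_comm]))
    (fun f g g' => pb_injective (by simp only [pb_MFun, map_add, mul_add]))
    (fun c f g => pb_injective (by simp only [pb_MFun, map_smul, mul_smul_comm]))

theorem pb_Mop (r : ℕ) (f g : Smooth q) :
    pb (Mop r f g) = xS ^ r * contr DZ DB r (pb f) (pb g) := pb_MFun r f g

theorem Mop_zero (f g : Smooth q) : Mop 0 f g = f * g :=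
  pb_injective (by rw [pb_Mop, contr_zero, pow_zero, one_mul, map_mul])

theorem Mop_succ_one_left (r : ℕ) (g : Smooth q) : Mop (r + 1) 1 g = 0 :=
  pb_injective (by
    rw [pb_Mop, contr_succ]
    simp only [map_one, Derivation.map_one_eq_zero, map_zero, LinearMap.zero_apply,
      Finset.sum_const_zero, mul_zero])

theorem Mop_succ_one_right (r : ℕ) (f : Smooth q) : Mop (r + 1) f 1 = 0 :=
  pb_injective (by
    rw [pb_Mop, contr_succ]
    simp only [map_one, Derivation.map_one_eq_zero, map_zero,
      Finset.sum_const_zero, mul_zero])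

theorem pb_conj (f : Smooth q) : pb (starRingEnd (Smooth q) f) = conjS (pb f) := by
  refine S_ext fun z => ?_
  rw [conjS_apply, pb_apply_mk, pb_apply_mk]
  rfl

theorem conj_Mop (r : ℕ) (f g : Smooth q) :
    starRingEnd (Smooth q) (Mop r f g) =
      Mop r (starRingEnd (Smooth q) g) (starRingEnd (Smooth q) f) :=
  pb_injective (by
    rw [pb_conj, pb_Mop, pb_Mop, map_mul, map_pow, conjS_xS, conjS_contr, pb_conj, pb_conj])

end Descent

/-! ### The star product -/

section Star

open PowerSeries Finset

variable {q : ℕ}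

/-- The coefficients of the star product on `CP^q`. -/
def starCoeff (μ : ℂ) (n : ℕ) : Smooth q →ₗ[ℂ] Smooth q →ₗ[ℂ] Smooth q :=
  ∑ r ∈ range (n + 1), coeff n (weightS μ r) • Mop r

theorem starCoeff_apply (μ : ℂ) (n : ℕ) (f g : Smooth q) :
    starCoeff μ n f g = ∑ r ∈ range (n + 1), coeff n (weightS μ r) • Mop r f g := by
  simp [starCoeff, LinearMap.sum_apply]

variable (q) in
/-- The star product on `CP^q`. -/
def starMul (μ : ℂ) : (Smooth q)⟦X⟧ →ₗ[ℂ⟦X⟧] (Smooth q)⟦X⟧ →ₗ[ℂ⟦X⟧] (Smooth q)⟦X⟧ :=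
  seriesBilin (starCoeff μ)

theorem coeff_starMul_C (μ : ℂ) (n : ℕ) (f g : Smooth q) :
    coeff n (starMul q μ (C f) (C g)) =
      ∑ r ∈ range (n + 1), coeff n (weightS μ r) • Mop r f g := by
  rw [starMul, seriesBilin_C, coeff_mk, starCoeff_apply]

/-- The coefficientwise pullback of formal power series. -/
def pbX : (Smooth q)⟦X⟧ →+* (S q)⟦X⟧ := PowerSeries.map (pb : Smooth q →ₐ[ℂ] S q).toRingHom

theorem coeff_pbX (a : (Smooth q)⟦X⟧) (n : ℕ) : coeff n (pbX a) = pb (coeff n a) := by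
  simp [pbX]

theorem pbX_C (f : Smooth q) : pbX (C f) = C (pb f) := by
  simp [pbX]

theorem pbX_X_mul (a : (Smooth q)⟦X⟧) : pbX (X * a) = X * pbX a := by
  simp [pbX]

theorem pbX_injective : Function.Injective (pbX : (Smooth q)⟦X⟧ → (S q)⟦X⟧) := fun a b h => by
  ext n : 1
  refine pb_injective ?_
  rw [← coeff_pbX, h, coeff_pbX]

theorem pbX_mem_seriesIn (a : (Smooth q)⟦X⟧) : pbX a ∈ seriesIn (homAlg q) := fun n => by
  rw [coeff_pbX]
  exact pb_mem_homAlg _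

theorem pbX_mem_seriesIn_invAlg (a : (Smooth q)⟦X⟧) : pbX a ∈ seriesIn (invAlg q) := fun n =>
  homAlg_le_invAlg (pbX_mem_seriesIn a n)

theorem wickS_C_sub_pbX_mem {μ : ℂ} (hμ : μ ≠ 0) (f g : Smooth q) :
    wickS (C (pb f)) (C (pb g)) - pbX (starMul q μ (C f) (C g)) ∈ starJ q μ := by
  have h := wickS_sub_mem_starJ hμ (pb_mem_homAlg f) (pb_mem_homAlg g)
  convert h using 2
  ext n
  rw [coeff_pbX, coeff_starMul_C, coeff_mk, map_sum]
  refine Finset.sum_congr rfl fun r _ => ?_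
  rw [map_smul, pb_Mop]

/-- Both products commute with `X` in each argument and the ideal is closed under formal sums, so
the congruence passes from functions to series. -/
theorem wickS_sub_pbX_mem {μ : ℂ} (hμ : μ ≠ 0) (a b : (Smooth q)⟦X⟧) :
    wickS (pbX a) (pbX b) - pbX (starMul q μ a b) ∈ starJ q μ := by
  have h1 : ∀ f, wickS (pbX (C f)) (pbX b) - pbX (starMul q μ (C f) b) ∈ starJ q μ := fun f =>
    map_mem_of_C (AddMonoidHom.mk' (fun b => wickS (pbX (C f)) (pbX b) - pbX (starMul q μ (C f) b))
        fun b b' => by simp only [map_add]; abel)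
      (fun b => by
        simp only [AddMonoidHom.mk'_apply, pbX_X_mul, wickS, starMul, seriesBilin_X_mul_right,
          mul_sub])
      (starJ q μ) (fun _ h => sumX_mem_starJ h)
      (fun g => by
        simp only [AddMonoidHom.mk'_apply, pbX_C]
        exact wickS_C_sub_pbX_mem hμ f g) b
  exact map_mem_of_C (AddMonoidHom.mk' (fun a => wickS (pbX a) (pbX b) - pbX (starMul q μ a b))
        fun b b' => by simp only [map_add, LinearMap.add_apply]; abel)
      (fun b => by
        simp only [AddMonoidHom.mk'_apply, pbX_X_mul, wickS, starMul, seriesBilin_X_mul_left,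
          mul_sub])
      (starJ q μ) (fun _ h => sumX_mem_starJ h) h1 a

theorem starMul_assoc {μ : ℝ} (hμ : 0 < μ) (a b d : (Smooth q)⟦X⟧) :
    starMul q μ (starMul q μ a b) d = starMul q μ a (starMul q μ b d) := by
  have hμ' : (μ : ℂ) ≠ 0 := by exact_mod_cast hμ.ne'
  refine pbX_injective (sub_eq_zero.1 (eq_zero_of_mem_starJ hμ ?_
    ((seriesIn (homAlg q)).sub_mem (pbX_mem_seriesIn _) (pbX_mem_seriesIn _))))
  have h1 := wickS_sub_pbX_mem hμ' (starMul q μ a b) d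
  have h2 := wickS_sub_pbX_mem hμ' a (starMul q μ b d)
  have h3 := wickS_mem_starJ_left (pbX_mem_seriesIn_invAlg d) (wickS_sub_pbX_mem hμ' a b)
  have h4 := wickS_mem_starJ_right (pbX_mem_seriesIn_invAlg a) (wickS_sub_pbX_mem hμ' b d)
  rw [map_sub, LinearMap.sub_apply, wickS_assoc] at h3
  rw [map_sub] at h4
  -- The triple Wick products in `h3` and `h4` agree by `wickS_assoc` and cancel, leaving the
  -- difference of the two bracketings.
  have h5 := (starJ q μ).sub_mem ((starJ q μ).add_mem h2 h4) ((starJ q μ).add_mem h1 h3)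
  convert h5 using 1
  abel

theorem weightS_zero (μ : ℂ) : weightS μ 0 = 1 := by
  simp [weightS, denProd]

theorem coeff_one_weightS_one {μ : ℂ} : coeff 1 (weightS μ 1) = μ⁻¹ := by
  rw [weightS, coeff_X_pow_mul', if_pos le_rfl]
  simp [denProd, den]

theorem starMul_one_left (μ : ℂ) (a : (Smooth q)⟦X⟧) : starMul q μ 1 a = a := by
  refine addHom_ext (starMul q μ 1).toAddMonoidHom (AddMonoidHom.id _)
    (fun a => seriesBilin_X_mul_right _ _ _) (fun a => rfl) (fun f => ?_) a
  change starMul q μ 1 (C f) = C f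
  rw [← map_one (C (R := Smooth q))]
  ext n : 1
  -- Only `r = 0` survives: every later term differentiates the constant `1`.
  rw [coeff_starMul_C, sum_range_succ', weightS_zero, Mop_zero, one_mul]
  simp only [Mop_succ_one_left, smul_zero, sum_const_zero, zero_add, coeff_one, coeff_C]
  split_ifs <;> simp

theorem starMul_one_right (μ : ℂ) (a : (Smooth q)⟦X⟧) : starMul q μ a 1 = a := by
  refine addHom_ext ((starMul q μ).flip 1).toAddMonoidHom (AddMonoidHom.id _)
    (fun a => seriesBilin_X_mul_left _ _ _) (fun a => rfl) (fun f => ?_) a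
  change starMul q μ (C f) 1 = C f
  rw [← map_one (C (R := Smooth q))]
  ext n : 1
  rw [coeff_starMul_C, sum_range_succ', weightS_zero, Mop_zero, mul_one]
  simp only [Mop_succ_one_right, smul_zero, sum_const_zero, zero_add, coeff_one, coeff_C]
  split_ifs <;> simp

theorem map_conj_den (μ : ℝ) (k : ℕ) : PowerSeries.map (starRingEnd ℂ) (den μ k) = den μ k := by
  simp [den]

/-- The factors `μ + k λ` are real, and so are their inverses by uniqueness. -/
theorem map_conj_weightS {μ : ℝ} (hμ : μ ≠ 0) (r : ℕ) :
    PowerSeries.map (starRingEnd ℂ) (weightS μ r) = weightS μ r := by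
  have h : ∀ k, PowerSeries.map (starRingEnd ℂ) (den μ k)⁻¹ = (den (μ : ℂ) k)⁻¹ := by
    intro k
    have h1 := den_mul_inv (μ := (μ : ℂ)) (by exact_mod_cast hμ) k
    have h2 := congrArg (PowerSeries.map (starRingEnd ℂ)) h1
    rw [map_mul, map_conj_den, map_one] at h2
    calc _ = (den (μ : ℂ) k * (den (μ : ℂ) k)⁻¹) *
          PowerSeries.map (starRingEnd ℂ) (den μ k)⁻¹ := by rw [h1, one_mul]
      _ = (den (μ : ℂ) k)⁻¹ * (den (μ : ℂ) k * PowerSeries.map (starRingEnd ℂ) (den μ k)⁻¹) := by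
        ring
      _ = _ := by rw [h2, mul_one]
  simp [weightS, denProd, h, map_prod]

theorem starMul_conj {μ : ℝ} (hμ : μ ≠ 0) (a b : (Smooth q)⟦X⟧) :
    PowerSeries.map (starRingEnd (Smooth q)) (starMul q μ a b) =
      starMul q μ (PowerSeries.map (starRingEnd (Smooth q)) b)
        (PowerSeries.map (starRingEnd (Smooth q)) a) := by
  have h0 : ∀ f g : Smooth q, PowerSeries.map (starRingEnd (Smooth q)) (starMul q μ (C f) (C g)) =
      starMul q μ (PowerSeries.map (starRingEnd (Smooth q)) (C g))
        (PowerSeries.map (starRingEnd (Smooth q)) (C f)) := fun f g => by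
    ext n : 1
    rw [map_C, map_C, coeff_map, coeff_starMul_C, coeff_starMul_C, map_sum]
    refine Finset.sum_congr rfl fun r _ => ?_
    have h1 : (starRingEnd ℂ) (coeff n (weightS (μ : ℂ) r)) = coeff n (weightS (μ : ℂ) r) := by
      rw [← coeff_map, map_conj_weightS hμ]
    rw [← conj_Mop, starRingEnd_apply, star_smul, ← starRingEnd_apply, h1, ← starRingEnd_apply]
  have h1 : ∀ f : Smooth q, PowerSeries.map (starRingEnd (Smooth q)) (starMul q μ (C f) b) =
      starMul q μ (PowerSeries.map (starRingEnd (Smooth q)) b)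
        (PowerSeries.map (starRingEnd (Smooth q)) (C f)) := fun f =>
    addHom_ext (((PowerSeries.map (starRingEnd (Smooth q))).toAddMonoidHom).comp
        (starMul q μ (C f)).toAddMonoidHom)
      (((starMul q μ).flip (PowerSeries.map (starRingEnd (Smooth q)) (C f))).toAddMonoidHom.comp
        (PowerSeries.map (starRingEnd (Smooth q))).toAddMonoidHom)
      (fun a => by simp [starMul, seriesBilin_X_mul_right])
      (fun a => by simp [starMul, seriesBilin_X_mul_left]) (h0 f) b
  exact addHom_ext (((PowerSeries.map (starRingEnd (Smooth q))).toAddMonoidHom).comp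
        ((starMul q μ).flip b).toAddMonoidHom)
      ((starMul q μ (PowerSeries.map (starRingEnd (Smooth q)) b)).toAddMonoidHom.comp
        (PowerSeries.map (starRingEnd (Smooth q))).toAddMonoidHom)
      (fun a => by simp [starMul, seriesBilin_X_mul_left])
      (fun a => by simp [starMul, seriesBilin_X_mul_right]) h1 a

/-- The summand `1` in `c = μ/λ + 1` shifts the index: the factor `c + r` of `[c]` corresponds to `μ
+ (r+1)λ`. -/
theorem den_eq_c (μ : ℝ) (r : ℕ) :
    (c μ + r) * HahnSeries.ofPowerSeries ℤ ℂ X = HahnSeries.ofPowerSeries ℤ ℂ (den μ (r + 1)) := by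
  have h : HahnSeries.single (-1 : ℤ) (μ : ℂ) * HahnSeries.single (1 : ℤ) (1 : ℂ) =
      HahnSeries.C (μ : ℂ) := by
    rw [HahnSeries.single_mul_single]
    simp
  simp only [c, den, map_add, map_mul, HahnSeries.ofPowerSeries_C, HahnSeries.ofPowerSeries_X,
    map_natCast, ← h]
  push_cast
  ring

/-- The power `λ^r` is distributed over the `r` factors of `[c]_r`, each of which becomes an
invertible power series. -/
theorem weight_eq {μ : ℝ} (hμ : μ ≠ 0) (r : ℕ) :
    weight μ r = HahnSeries.ofPowerSeries ℤ ℂ (weightS μ r) := by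
  have h1 : (ascPochhammer (LaurentSeries ℂ) r).eval (c μ) *
      HahnSeries.ofPowerSeries ℤ ℂ (X ^ r * denProd μ r) = 1 := by
    induction r with
    | zero => simp [denProd]
    | succ r ih =>
      have h2 := congrArg (HahnSeries.ofPowerSeries ℤ ℂ)
        (den_mul_inv (μ := (μ : ℂ)) (by exact_mod_cast hμ) (r + 1))
      rw [map_mul, map_one, ← den_eq_c] at h2
      rw [ascPochhammer_succ_eval, denProd, prod_range_succ, ← denProd, pow_succ]
      calc _ = ((ascPochhammer (LaurentSeries ℂ) r).eval (c μ) *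
            HahnSeries.ofPowerSeries ℤ ℂ (X ^ r * denProd μ r)) *
            ((c μ + r) * HahnSeries.ofPowerSeries ℤ ℂ X *
              HahnSeries.ofPowerSeries ℤ ℂ (den μ (r + 1))⁻¹) := by
            simp only [map_mul]
            ring
        _ = 1 := by rw [ih, h2, one_mul]
  have h3 : (r.factorial : LaurentSeries ℂ) *
      HahnSeries.ofPowerSeries ℤ ℂ (C (r.factorial : ℂ)⁻¹) = 1 := by
    rw [← map_natCast (HahnSeries.ofPowerSeries ℤ ℂ), ← map_mul, ← map_natCast (C (R := ℂ)),
      ← map_mul, mul_inv_cancel₀ (by exact_mod_cast r.factorial_ne_zero), map_one, map_one]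
  rw [weight, one_div]
  refine inv_eq_of_mul_eq_one_right ?_
  calc _ = ((r.factorial : LaurentSeries ℂ) *
      HahnSeries.ofPowerSeries ℤ ℂ (C (r.factorial : ℂ)⁻¹)) *
      ((ascPochhammer (LaurentSeries ℂ) r).eval (c μ) *
      HahnSeries.ofPowerSeries ℤ ℂ (X ^ r * denProd μ r)) := by
        simp only [weightS, map_mul]
        ring
    _ = 1 := by rw [h1, h3, one_mul]

theorem weight_coeff_natCast {μ : ℝ} (hμ : μ ≠ 0) (r n : ℕ) :
    (weight μ r).coeff (n : ℤ) = coeff n (weightS μ r) := by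
  rw [weight_eq hμ, LaurentSeries.coeff_coe_powerSeries]

theorem weight_coeff_of_lt {μ : ℝ} (hμ : μ ≠ 0) (r : ℕ) (n : ℤ) (hn : n < r) :
    (weight μ r).coeff n = 0 := by
  rw [weight_eq hμ, PowerSeries.coeff_coe]
  split_ifs with h
  · rfl
  · exact coeff_weightS_of_lt _ (by omega)

end Star

/-! ### Comparison with the operations on functions on `ℂ^{q+1}` -/

section Compare

open PowerSeries Finset

variable {q : ℕ}

theorem dzIter_eq (F : V q → ℂ) (F' : S q) (h : ∀ z, F'.1 z = F z.1) {r : ℕ}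
    (A : Fin r → Fin (q + 1)) (z : Punct q) : (iterD DZ A F').1 z = dzIter A F z := by
  unfold iterD dzIter
  induction List.ofFn A generalizing z with
  | nil => exact h z
  | cons B l ih => exact DZ_eq_dz B _ _ ih z

theorem dzbarIter_eq (F : V q → ℂ) (F' : S q) (h : ∀ z, F'.1 z = F z.1) {r : ℕ}
    (A : Fin r → Fin (q + 1)) (z : Punct q) : (iterD DB A F').1 z = dzbarIter A F z := by
  unfold iterD dzbarIter
  induction List.ofFn A generalizing z with
  | nil => exact h z
  | cons B l ih => exact DB_eq_dzbar B _ _ ih z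

theorem contr_eq_contraction (F G : V q → ℂ) (F' G' : S q) (hF : ∀ z, F'.1 z = F z.1)
    (hG : ∀ z, G'.1 z = G z.1) (r : ℕ) (z : Punct q) :
    (contr DZ DB r F' G').1 z = contraction r F G z := by
  rw [contr_apply, S_sum_apply]
  refine Finset.sum_congr rfl fun A _ => ?_
  rw [S_mul, Pi.mul_apply, dzIter_eq F F' hF, dzbarIter_eq G G' hG]

theorem wickS_eq_wick (F G : (V q → ℂ)⟦X⟧) (F' G' : (S q)⟦X⟧)
    (hF : ∀ n z, (coeff n F').1 z = coeff n F z.1)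
    (hG : ∀ n z, (coeff n G').1 z = coeff n G z.1) (n : ℕ) (z : Punct q) :
    (coeff n (wickS F' G')).1 z = coeff n (wick F G) z.1 := by
  rw [wickS, coeff_seriesBilin, S_sum_apply, wick, coeff_mk]
  refine Finset.sum_congr rfl fun p _ => ?_
  rw [S_sum_apply, Finset.mul_sum]
  refine Finset.sum_congr rfl fun s _ => ?_
  rw [wickCoeff_apply, S_smul, Pi.smul_apply, smul_eq_mul,
    contr_eq_contraction _ _ _ _ (hF s.1) (hG s.2)]

theorem C_toS_eq (F : V q → ℂ) (F' : S q) (h : ∀ z, F'.1 z = F z.1) (n : ℕ) (z : Punct q) :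
    (coeff n (C F')).1 z = coeff n (C F) z.1 := by
  rw [coeff_C, coeff_C]
  split_ifs
  · exact h z
  · rfl

theorem isHomogeneous_iff (F : V q → ℂ) (F' : S q) (h : ∀ z, F'.1 z = F z.1) :
    IsHomogeneous F ↔ F' ∈ homAlg q := by
  constructor
  · rintro ⟨-, h2⟩ u
    refine S_ext fun z => ?_
    rw [scale_apply, h, h]
    exact h2 u u.ne_zero z.1 z.2
  · intro h2
    refine ⟨(contDiffOn_ext_iff F F'.1 h).1 (S_contDiffOn F'), fun u hu z hz => ?_⟩
    have h3 := congrArg (fun F : S q => F.1 ⟨z, hz⟩) (h2 (Units.mk0 u hu))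
    rw [scale_apply, h, h] at h3
    exact h3

theorem isInvariant_iff (F : V q → ℂ) (F' : S q) (h : ∀ z, F'.1 z = F z.1) :
    IsInvariant F ↔ F' ∈ invAlg q := by
  constructor
  · rintro ⟨-, h2⟩ u hu
    refine S_ext fun z => ?_
    rw [scale_apply, h, h]
    exact h2 u hu z.1 z.2
  · intro h2
    refine ⟨(contDiffOn_ext_iff F F'.1 h).1 (S_contDiffOn F'), fun u hu z hz => ?_⟩
    have hu0 : u ≠ 0 := fun h0 => by simp [h0] at hu
    have h3 := congrArg (fun F : S q => F.1 ⟨z, hz⟩) (h2 (Units.mk0 u hu0) hu)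
    rw [scale_apply, h, h] at h3
    exact h3

/-- Restriction of a formal power series with smooth coefficients to the punctured space. -/
theorem exists_restrict (F : (V q → ℂ)⟦X⟧) (hF : ∀ n, ContDiffOn ℝ ∞ (coeff n F) {0}ᶜ) :
    ∃ F' : (S q)⟦X⟧, ∀ n z, (coeff n F').1 z = coeff n F z.1 :=
  ⟨PowerSeries.mk fun n => toS _ (hF n), fun n z => by rw [coeff_mk, toS_apply]⟩

/-- Membership only involves values off the origin, so multipliers pass between the two settings by
restriction and by extension by zero. -/
theorem mem_starIdeal_iff (μ : ℝ) (K : (V q → ℂ)⟦X⟧) (K' : (S q)⟦X⟧)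
    (hK : ∀ n z, (coeff n K').1 z = coeff n K z.1) :
    K ∈ starIdeal q μ ↔ K' ∈ starJ q μ := by
  have hx : ∀ n z, (coeff n (C (xm (μ : ℂ)) : (S q)⟦X⟧)).1 z =
      coeff n (C (fun z : V q => ((x z - μ : ℝ) : ℂ))) z.1 := C_toS_eq _ _ (xm_apply μ)
  constructor
  · rintro ⟨G, hG, h⟩
    obtain ⟨G', hG'⟩ := exists_restrict G fun n => (hG n).1
    refine mem_starJ.2 ⟨G', fun n => (isInvariant_iff _ _ (hG' n)).1 (hG n), ?_⟩
    ext n : 1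
    refine S_ext fun z => ?_
    rw [wickS_eq_wick _ _ _ _ hG' hx, hK, h n z.1 z.2]
  · intro h
    obtain ⟨G', hG', rfl⟩ := mem_starJ.1 h
    have hext : ∀ n z, (coeff n G').1 z =
        coeff n (PowerSeries.mk fun n => ext (coeff n G').1) z.1 := fun n z => by
      rw [coeff_mk, ext_apply]
    refine ⟨PowerSeries.mk fun n => ext (coeff n G').1,
      fun n => (isInvariant_iff _ _ (hext n)).2 (hG' n), fun n z hz => ?_⟩
    rw [← wickS_eq_wick _ _ _ _ hext hx n ⟨z, hz⟩, hK]

/-- Existence is the congruence `wickS_C_sub_pbX_mem`. For uniqueness, two homogeneous parts differ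
by a homogeneous series in the ideal. -/
theorem isHomogeneousPart_iff {μ : ℝ} (hμ : 0 < μ) (f g : Smooth q) (H : (V q → ℂ)⟦X⟧) :
    IsHomogeneousPart μ (wick (C (pullback f)) (C (pullback g))) H ↔
      ∀ (n : ℕ) (z : V q), z ≠ 0 →
        coeff n H z = pullback (coeff n (starMul q μ (C f) (C g))) z := by
  have hμ' : (μ : ℂ) ≠ 0 := by exact_mod_cast hμ.ne'
  have hW : ∀ n z, (coeff n (wickS (C (pb f)) (C (pb g)))).1 z =
      coeff n (wick (C (pullback f)) (C (pullback g))) z.1 :=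
    wickS_eq_wick _ _ _ _ (C_toS_eq _ _ (pb_apply f)) (C_toS_eq _ _ (pb_apply g))
  have hJ := wickS_C_sub_pbX_mem hμ' f g
  constructor
  · rintro ⟨h1, h2⟩ n z hz
    obtain ⟨H', hH'⟩ := exists_restrict H fun n => (h1 n).1
    have h3 : H' ∈ seriesIn (homAlg q) := fun n => (isHomogeneous_iff _ _ (hH' n)).1 (h1 n)
    rw [mem_starIdeal_iff μ _ (wickS (C (pb f)) (C (pb g)) - H')
      (fun n z => by rw [map_sub, map_sub, S_sub, Pi.sub_apply, Pi.sub_apply, hW, hH'])] at h2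
    have h4 := (starJ q μ).sub_mem hJ h2
    rw [sub_sub_sub_cancel_left] at h4
    have h5 := eq_zero_of_mem_starJ hμ h4
      ((seriesIn (homAlg q)).sub_mem h3 (pbX_mem_seriesIn _))
    have h6 := hH' n ⟨z, hz⟩
    rw [sub_eq_zero.1 h5, coeff_pbX, pb_apply] at h6
    exact h6.symm
  · intro h
    have hH : ∀ n z, (coeff n (pbX (starMul q μ (C f) (C g)))).1 z = coeff n H z.1 :=
      fun n z => by rw [coeff_pbX, pb_apply, h n z.1 z.2]
    refine ⟨fun n => (isHomogeneous_iff _ _ (hH n)).2 (pbX_mem_seriesIn _ n), ?_⟩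
    rw [mem_starIdeal_iff μ _ (wickS (C (pb f)) (C (pb g)) - pbX (starMul q μ (C f) (C g)))
      (fun n z => by rw [map_sub, map_sub, S_sub, Pi.sub_apply, Pi.sub_apply, hW, hH])]
    exact hJ

theorem pb_Mop_eq_M (r : ℕ) (f g : Smooth q) (z : Punct q) :
    (pb (Mop r f g)).1 z = M r (pullback f) (pullback g) z.1 := by
  rw [pb_Mop, S_mul, Pi.mul_apply, S_pow, Pi.pow_apply, xS_apply,
    contr_eq_contraction _ _ _ _ (pb_apply f) (pb_apply g), M]

/-- The retraction is scaling by `u = (μ/x)^{1/2}`, and the contraction scales by `‖u‖^{2r}`; then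
`x^r (μ/x)^r = μ^r`. -/
theorem M_eq_retract {μ : ℝ} (hμ : 0 < μ) (r : ℕ) (f g : Smooth q) (z : Punct q) :
    M r (pullback f) (pullback g) z.1 =
      (μ : ℂ) ^ r * contraction r (pullback f) (pullback g) (retract μ z.1) := by
  have hx := x_pos z
  have h : (Real.sqrt μ / Real.sqrt (x z.1) : ℝ) ≠ 0 :=
    (div_pos (Real.sqrt_pos.2 hμ) (Real.sqrt_pos.2 hx)).ne'
  let u : ℂˣ := Units.mk0 ((Real.sqrt μ / Real.sqrt (x z.1) : ℝ) : ℂ) (by exact_mod_cast h)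
  have h1 : retract μ z.1 = (smulPunct u z).1 := by
    funext A
    simp [retract, smulPunct, u]
  have h2 : (contr DZ DB r (pb f) (pb g)).1 z = (((‖(u : ℂ)‖ : ℂ) ^ 2) ^ r) *
      (contr DZ DB r (pb f) (pb g)).1 (smulPunct u z) := by
    have h3 := congrArg (fun F : S q => F.1 z)
      (scale_contr_of_mem_homAlg (pb_mem_homAlg f) (pb_mem_homAlg g) r u)
    rw [S_smul, Pi.smul_apply, scale_apply] at h3
    exact h3
  have h4 : ((‖(u : ℂ)‖ : ℂ) ^ 2) = μ / x z.1 := by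
    have h5 : ‖(u : ℂ)‖ ^ 2 = μ / x z.1 := by
      change ‖((Real.sqrt μ / Real.sqrt (x z.1) : ℝ) : ℂ)‖ ^ 2 = _
      rw [Complex.norm_real, Real.norm_eq_abs, sq_abs, div_pow, Real.sq_sqrt hμ.le,
        Real.sq_sqrt hx.le]
    exact_mod_cast congrArg (fun t : ℝ => (t : ℂ)) h5
  have hx' : (x z.1 : ℂ) ≠ 0 := by exact_mod_cast hx.ne'
  rw [M, h1, ← contr_eq_contraction _ _ _ _ (pb_apply f) (pb_apply g),
    ← contr_eq_contraction _ _ _ _ (pb_apply f) (pb_apply g), h2, h4, ← mul_assoc, ← mul_pow]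
  congr 2
  field_simp

/-- Only `M_1` enters, with weight `μ⁻¹` cancelling `x = μ`. Antisymmetrizing `∂_A f ∂̄_A g` gives
`i/2` times the real bracket. -/
theorem first_order_starMul {μ : ℝ} (hμ : 0 < μ) (f g : Smooth q) (ζ : V q) (hζ : ζ ≠ 0)
    (hx : x ζ = μ) :
    (coeff 1 (starMul q μ (C f) (C g) - starMul q μ (C g) (C f))).1
        (Projectivization.mk ℂ ζ hζ) =
      Complex.I / 2 * poisson (pullback f) (pullback g) ζ := by
  have hμ' : (μ : ℂ) ≠ 0 := by exact_mod_cast hμ.ne'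
  have h1 : coeff 1 (starMul q μ (C f) (C g) - starMul q μ (C g) (C f)) =
      (μ : ℂ)⁻¹ • (Mop 1 f g - Mop 1 g f) := by
    rw [map_sub, coeff_starMul_C, coeff_starMul_C]
    simp only [sum_range_succ, range_zero, sum_empty, weightS_zero, coeff_one_weightS_one]
    simp [coeff_one, smul_sub]
  have h2 : ∀ f g : Smooth q, (pb (Mop 1 f g)).1 ⟨ζ, hζ⟩ =
      μ * ∑ A, dz A (pullback f) ζ * dzbar A (pullback g) ζ := by
    intro f g
    rw [pb_Mop, contr_succ, pow_one, S_mul, Pi.mul_apply, S_sum_apply, xS_apply, hx]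
    congr 1
    refine Finset.sum_congr rfl fun A _ => ?_
    rw [contr_zero, S_mul, Pi.mul_apply, DZ_eq_dz A _ _ (pb_apply f),
      DB_eq_dzbar A _ _ (pb_apply g)]
  rw [h1, ← pb_apply_mk _ ⟨ζ, hζ⟩, map_smul, map_sub, S_smul, S_sub, Pi.smul_apply, Pi.sub_apply,
    h2, h2, ← mul_sub, smul_eq_mul, inv_mul_cancel_left₀ hμ', poisson, Finset.mul_sum,
    ← Finset.sum_sub_distrib]
  refine Finset.sum_congr rfl fun A _ => ?_
  rw [dz, dz, dzbar, dzbar]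
  ring

end Compare

/-! ### Differential operators in affine charts -/

section DiffOp

open Finset

variable {q : ℕ}

/-- The partial derivative of order `k` of `f` in the `i`-th chart, as a function on the domain of
the chart. -/
def chartDeriv (i : Fin (q + 1)) (f : Smooth q) (k : ℕ) (s : Fin k → Fin q × Bool) (z : V q) : ℂ :=
  iteratedFDeriv ℝ k (fun w => f.1 (affine i w)) (chart i z) fun j => realBasis (s j)

/-- The maps `f ↦ L f` that are differential operators of order at most `N` over the domain of the
`i`-th chart. -/
def IsDiffOp (i : Fin (q + 1)) (N : ℕ) (L : Smooth q → V q → ℂ) : Prop :=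
  ∃ b : (k : ℕ) → (Fin k → Fin q × Bool) → V q → ℂ,
    (∀ k s, ContDiffOn ℝ ∞ (b k s) {z | z i ≠ 0}) ∧
    ∀ f z, z i ≠ 0 → L f z = ∑ k ∈ range (N + 1), ∑ s, b k s z * chartDeriv i f k s z

variable {i : Fin (q + 1)} {N : ℕ} {L L' : Smooth q → V q → ℂ}

theorem IsDiffOp.congr (h : IsDiffOp i N L) (h' : ∀ f z, z i ≠ 0 → L' f z = L f z) :
    IsDiffOp i N L' := by
  obtain ⟨b, hb, h⟩ := h
  exact ⟨b, hb, fun f z hz => (h' f z hz).trans (h f z hz)⟩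

theorem IsDiffOp.add (h : IsDiffOp i N L) (h' : IsDiffOp i N L') :
    IsDiffOp i N fun f z => L f z + L' f z := by
  obtain ⟨b, hb, h⟩ := h
  obtain ⟨b', hb', h'⟩ := h'
  refine ⟨fun k s z => b k s z + b' k s z, fun k s => (hb k s).add (hb' k s), fun f z hz => ?_⟩
  simp only [h f z hz, h' f z hz, add_mul, sum_add_distrib]

theorem IsDiffOp.const_mul (h : IsDiffOp i N L) (c : ℂ) :
    IsDiffOp i N fun f z => c * L f z := by
  obtain ⟨b, hb, h⟩ := h
  refine ⟨fun k s z => c * b k s z, fun k s => contDiffOn_const.mul (hb k s), fun f z hz => ?_⟩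
  simp only [h f z hz, mul_sum, mul_assoc]

theorem IsDiffOp.zero : IsDiffOp i N fun _ _ => 0 :=
  ⟨fun _ _ _ => 0, fun _ _ => contDiffOn_const, fun f z _ => by simp⟩

theorem IsDiffOp.sum {α : Type*} (t : Finset α) {L : α → Smooth q → V q → ℂ}
    (h : ∀ a ∈ t, IsDiffOp i N (L a)) : IsDiffOp i N fun f z => ∑ a ∈ t, L a f z := by
  classical
  induction t using Finset.induction_on with
  | empty => simpa using IsDiffOp.zero
  | insert a t ha ih =>
    simp only [sum_insert ha]
    exact (h a (mem_insert_self a t)).add (ih fun b hb => h b (mem_insert_of_mem hb))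

theorem IsDiffOp.mono (h : IsDiffOp i N L) {N' : ℕ} (hN : N ≤ N') : IsDiffOp i N' L := by
  obtain ⟨b, hb, h⟩ := h
  refine ⟨fun k s z => if k < N + 1 then b k s z else 0, fun k s => ?_, fun f z hz => ?_⟩
  · by_cases hk : k < N + 1
    · simpa [hk] using hb k s
    · simpa [hk] using contDiffOn_const
  · rw [h f z hz]
    refine (sum_congr rfl fun k hk => ?_).trans
      (sum_subset (range_subset_range.2 (by omega)) fun k _ hk => ?_)
    · simp [mem_range.1 hk]
    · rw [mem_range] at hk
      simp [hk]

theorem IsDiffOp.single (b : V q → ℂ) (hb : ContDiffOn ℝ ∞ b {z | z i ≠ 0}) {k : ℕ}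
    (hk : k ≤ N) (s : Fin k → Fin q × Bool) :
    IsDiffOp i N fun f z => b z * chartDeriv i f k s z := by
  classical
  have h0 : ContDiffOn ℝ ∞ (0 : V q → ℂ) {z | z i ≠ 0} := contDiffOn_const
  refine ⟨Pi.single k (Pi.single s b), fun l t => ?_, fun f z hz => ?_⟩
  · by_cases hl : l = k
    · subst hl
      by_cases ht : t = s
      · subst ht
        simpa using hb
      · simpa [ht] using h0
    · simpa [hl] using h0
  · rw [sum_eq_single k, sum_eq_single s]
    · simp
    · intro t _ ht
      simp [ht]
    · simp
    · intro l _ hl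
      simp [hl]
    · intro h
      exact absurd (mem_range.2 (by omega)) h

/-- The components of the derivative of a chart in a fixed direction. -/
def chartComp (i : Fin (q + 1)) (v : V q) (d : Fin q × Bool) (z : V q) : ℝ :=
  if d.2 then (fderiv ℝ (chart i) z v d.1).im else (fderiv ℝ (chart i) z v d.1).re

theorem contDiffOn_chartComp (i : Fin (q + 1)) (v : V q) (d : Fin q × Bool) :
    ContDiffOn ℝ ∞ (fun z => (chartComp i v d z : ℂ)) {z | z i ≠ 0} := by
  have h : ContDiffOn ℝ ∞ (fun z => fderiv ℝ (chart i) z v d.1) {z | z i ≠ 0} :=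
    contDiffOn_pi.1 (((contDiffOn_chart i).fderiv_of_isOpen (isOpen_chart i)
      (by simp)).clm_apply contDiffOn_const) d.1
  have h' : ContDiffOn ℝ ∞ (chartComp i v d) {z | z i ≠ 0} := by
    unfold chartComp
    split_ifs
    · exact Complex.imCLM.contDiff.comp_contDiffOn h
    · exact Complex.reCLM.contDiff.comp_contDiffOn h
  exact Complex.ofRealCLM.contDiff.comp_contDiffOn h'

theorem eq_sum_realBasis (u : Fin q → ℂ) :
    u = ∑ d : Fin q × Bool, (if d.2 then (u d.1).im else (u d.1).re) • realBasis d := by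
  funext a
  rw [Fintype.sum_prod_type]
  simp [realBasis, Finset.sum_apply, Pi.single_apply, Finset.sum_add_distrib, add_comm]

/-- The chain rule: the image of `v` under the differential of the chart is expanded in the real
basis, and each basis direction is prepended to the multi-index. -/
theorem hasFDerivAt_chartDeriv (f : Smooth q) (k : ℕ) (s : Fin k → Fin q × Bool) (z : V q)
    (hz : z i ≠ 0) (v : V q) :
    DifferentiableAt ℝ (chartDeriv i f k s) z ∧
    fderiv ℝ (chartDeriv i f k s) z v = ∑ d, (chartComp i v d z : ℂ) *
      chartDeriv i f (k + 1) (Fin.cons d s : Fin (k + 1) → Fin q × Bool) z := by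
  have h1 : HasFDerivAt (chart i) (fderiv ℝ (chart i) z) z :=
    (((contDiffOn_chart i).contDiffAt ((isOpen_chart i).mem_nhds hz)).differentiableAt
      (by simp)).hasFDerivAt
  have h2 : HasFDerivAt (iteratedFDeriv ℝ k fun w => f.1 (affine i w))
      (fderiv ℝ (iteratedFDeriv ℝ k fun w => f.1 (affine i w)) (chart i z)) (chart i z) :=
    ((f.2 i).differentiable_iteratedFDeriv (by exact_mod_cast WithTop.coe_lt_top k)
      _).hasFDerivAt
  have h3 := (h2.comp z h1).continuousMultilinear_apply_const (fun j => realBasis (s j))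
  refine ⟨h3.differentiableAt, ?_⟩
  have h4 : fderiv ℝ (chartDeriv i f k s) z v =
      fderiv ℝ (iteratedFDeriv ℝ k fun w => f.1 (affine i w)) (chart i z)
        (fderiv ℝ (chart i) z v) fun j => realBasis (s j) :=
    congrArg (fun L => L v) h3.fderiv
  rw [h4, eq_sum_realBasis (fderiv ℝ (chart i) z v), map_sum,
    _root_.sum_apply]
  refine sum_congr rfl fun d _ => ?_
  rw [map_smul, _root_.smul_apply, Complex.real_smul, chartDeriv,
    iteratedFDeriv_succ_apply_left]
  rfl

/-- By the product rule the derivative falls on a coefficient, keeping the order, or on a partial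
derivative in the chart, raising it by one. -/
theorem IsDiffOp.fderiv_apply (h : IsDiffOp i N L) (v : V q) :
    IsDiffOp i (N + 1) fun f z => fderiv ℝ (L f) z v := by
  obtain ⟨b, hb, h⟩ := h
  have h1 : IsDiffOp i (N + 1) fun f z => ∑ k ∈ range (N + 1), ∑ s : Fin k → Fin q × Bool,
      (fderiv ℝ (b k s) z v * chartDeriv i f k s z +
        ∑ d, (b k s z * chartComp i v d z) *
          chartDeriv i f (k + 1) (Fin.cons d s : Fin (k + 1) → Fin q × Bool) z) := by
    refine IsDiffOp.sum _ fun k hk => IsDiffOp.sum _ fun s _ => IsDiffOp.add ?_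
      (IsDiffOp.sum _ fun d _ => ?_)
    · exact IsDiffOp.single _ (((hb k s).fderiv_of_isOpen (isOpen_chart i)
        (by simp)).clm_apply contDiffOn_const) (mem_range.1 hk).le s
    · exact IsDiffOp.single _ ((hb k s).mul (contDiffOn_chartComp i v d))
        (Nat.lt_iff_add_one_le.1 (mem_range.1 hk)) _
  refine h1.congr fun f z hz => ?_
  have h2 : L f =ᶠ[nhds z] fun z => ∑ k ∈ range (N + 1), ∑ s, b k s z * chartDeriv i f k s z := by
    filter_upwards [(isOpen_chart i).mem_nhds hz] with y hy using h f y hy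
  have hbd : ∀ k s, DifferentiableAt ℝ (b k s) z := fun k s =>
    ((hb k s).contDiffAt ((isOpen_chart i).mem_nhds hz)).differentiableAt (by simp)
  have hcd : ∀ k s, DifferentiableAt ℝ (chartDeriv i f k s) z := fun k s =>
    (hasFDerivAt_chartDeriv f k s z hz v).1
  rw [h2.fderiv_eq, fderiv_fun_sum fun k _ => DifferentiableAt.fun_sum fun s _ =>
    (hbd k s).fun_mul (hcd k s), _root_.sum_apply]
  refine sum_congr rfl fun k _ => ?_
  rw [fderiv_fun_sum fun s _ => (hbd k s).fun_mul (hcd k s), _root_.sum_apply]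
  refine sum_congr rfl fun s _ => ?_
  rw [fderiv_fun_mul (hbd k s) (hcd k s)]
  simp only [_root_.add_apply, _root_.smul_apply, smul_eq_mul,
    (hasFDerivAt_chartDeriv f k s z hz v).2, mul_sum]
  rw [add_comm, mul_comm]
  congr 1
  exact sum_congr rfl fun d _ => (mul_assoc _ _ _).symm

theorem IsDiffOp.dz (h : IsDiffOp i N L) (A : Fin (q + 1)) :
    IsDiffOp i (N + 1) fun f => CPStar.dz A (L f) := by
  refine (((h.fderiv_apply (Pi.single A 1)).add
    ((h.fderiv_apply (Pi.single A Complex.I)).const_mul (-Complex.I))).const_mul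
      (1 / 2)).congr fun f z _ => ?_
  rw [CPStar.dz]
  ring

theorem IsDiffOp.dzbar (h : IsDiffOp i N L) (A : Fin (q + 1)) :
    IsDiffOp i (N + 1) fun f => CPStar.dzbar A (L f) := by
  refine (((h.fderiv_apply (Pi.single A 1)).add
    ((h.fderiv_apply (Pi.single A Complex.I)).const_mul Complex.I)).const_mul
      (1 / 2)).congr fun f z _ => ?_
  rw [CPStar.dzbar]

theorem isDiffOp_pullback : IsDiffOp i 0 pullback := by
  refine (IsDiffOp.single (fun _ => 1) contDiffOn_const le_rfl Fin.elim0).congr fun f z hz => ?_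
  rw [chartDeriv, iteratedFDeriv_zero_apply, one_mul, pullback_eq_chart f i z hz]

theorem isDiffOp_dzIter {r : ℕ} (A : Fin r → Fin (q + 1)) :
    IsDiffOp i r fun f => dzIter A (pullback f) := by
  have h : ∀ l : List (Fin (q + 1)), IsDiffOp i l.length fun f => l.foldr dz (pullback f) := by
    intro l
    induction l with
    | nil => exact isDiffOp_pullback
    | cons B l ih => exact ih.dz B
  simpa [dzIter] using h (List.ofFn A)

theorem isDiffOp_dzbarIter {r : ℕ} (A : Fin r → Fin (q + 1)) :
    IsDiffOp i r fun f => dzbarIter A (pullback f) := by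
  have h : ∀ l : List (Fin (q + 1)), IsDiffOp i l.length fun f => l.foldr dzbar (pullback f) := by
    intro l
    induction l with
    | nil => exact isDiffOp_pullback
    | cons B l ih => exact ih.dzbar B
  simpa [dzbarIter] using h (List.ofFn A)

/-! ### Bidifferential operators -/

/-- The maps `(f, g) ↦ B f g` that are bidifferential operators of order at most `N` in the `i`-th
chart. -/
def IsBidiffOp (i : Fin (q + 1)) (N : ℕ) (B : Smooth q → Smooth q → (Fin q → ℂ) → ℂ) : Prop :=
  ∃ a : (k l : ℕ) → (Fin k → Fin q × Bool) → (Fin l → Fin q × Bool) → (Fin q → ℂ) → ℂ,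
    (∀ k l S T, ContDiff ℝ ∞ (a k l S T)) ∧
    ∀ (f g : Smooth q) (w : Fin q → ℂ),
      B f g w =
        ∑ k ∈ Finset.range (N + 1), ∑ l ∈ Finset.range (N + 1),
          ∑ S : Fin k → Fin q × Bool, ∑ T : Fin l → Fin q × Bool,
            a k l S T w
              * iteratedFDeriv ℝ k (fun v => f.1 (affine i v)) w (fun j => realBasis (S j))
              * iteratedFDeriv ℝ l (fun v => g.1 (affine i v)) w (fun j => realBasis (T j))

variable {B B' : Smooth q → Smooth q → (Fin q → ℂ) → ℂ}

theorem IsBidiffOp.add (h : IsBidiffOp i N B) (h' : IsBidiffOp i N B') :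
    IsBidiffOp i N fun f g w => B f g w + B' f g w := by
  obtain ⟨a, ha, h⟩ := h
  obtain ⟨a', ha', h'⟩ := h'
  refine ⟨fun k l S T w => a k l S T w + a' k l S T w,
    fun k l S T => (ha k l S T).add (ha' k l S T), fun f g w => ?_⟩
  simp only [h f g w, h' f g w, add_mul, sum_add_distrib]

theorem IsBidiffOp.mul_left (h : IsBidiffOp i N B) {c : (Fin q → ℂ) → ℂ} (hc : ContDiff ℝ ∞ c) :
    IsBidiffOp i N fun f g w => c w * B f g w := by
  obtain ⟨a, ha, h⟩ := h
  refine ⟨fun k l S T w => c w * a k l S T w, fun k l S T => hc.mul (ha k l S T),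
    fun f g w => ?_⟩
  simp only [h f g w, mul_sum, mul_assoc]

theorem IsBidiffOp.sum {α : Type*} (t : Finset α)
    {B : α → Smooth q → Smooth q → (Fin q → ℂ) → ℂ} (h : ∀ a ∈ t, IsBidiffOp i N (B a)) :
    IsBidiffOp i N fun f g w => ∑ a ∈ t, B a f g w := by
  classical
  induction t using Finset.induction_on with
  | empty => exact ⟨fun _ _ _ _ _ => 0, fun _ _ _ _ => contDiff_const, fun f g w => by simp⟩
  | insert a t ha ih =>
    simp only [sum_insert ha]
    exact (h a (mem_insert_self a t)).add (ih fun b hb => h b (mem_insert_of_mem hb))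

/-- On the slice `z_i = 1` the chart inverts `insertNth`, so derivatives over the chart domain
become partial derivatives at `w`, with smoothly restricted coefficients. -/
theorem IsDiffOp.mul (h : IsDiffOp i N L) (h' : IsDiffOp i N L') :
    IsBidiffOp i N fun f g w =>
      L f (i.insertNth (1 : ℂ) w : V q) * L' g (i.insertNth (1 : ℂ) w : V q) := by
  obtain ⟨b, hb, h⟩ := h
  obtain ⟨b', hb', h'⟩ := h'
  have hi : ∀ w : Fin q → ℂ, (i.insertNth (1 : ℂ) w : V q) i ≠ 0 := fun w => by simp
  refine ⟨fun k l S T w => b k S (i.insertNth (1 : ℂ) w : V q) *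
    b' l T (i.insertNth (1 : ℂ) w : V q), fun k l S T =>
      ((hb k S).comp_contDiff (contDiff_insertNth i) hi).mul
        ((hb' l T).comp_contDiff (contDiff_insertNth i) hi), fun f g w => ?_⟩
  beta_reduce
  rw [h f _ (hi w), h' g _ (hi w), sum_mul_sum]
  refine sum_congr rfl fun k _ => sum_congr rfl fun l _ => ?_
  rw [sum_mul_sum]
  refine sum_congr rfl fun S _ => sum_congr rfl fun T _ => ?_
  rw [chartDeriv, chartDeriv, chart_insertNth]
  ring

theorem contDiff_x : ContDiff ℝ ∞ fun z : V q => (x z : ℂ) := by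
  have h : ContDiff ℝ ∞ (x : V q → ℝ) := by
    unfold x
    exact ContDiff.sum fun A _ => (contDiff_apply ℝ ℂ A).norm_sq ℝ
  exact Complex.ofRealCLM.contDiff.comp h

theorem isBidifferential_starMul (μ : ℂ) (n : ℕ) :
    IsBidifferential fun f g : Smooth q =>
      PowerSeries.coeff n (starMul q μ (PowerSeries.C f) (PowerSeries.C g)) := by
  intro i
  -- The coefficient of `λ^n` involves only `r ≤ n`, and the `r`-th term has order at most `r` in
  -- each argument.
  refine ⟨n, ?_⟩
  have h : IsBidiffOp i n fun (f g : Smooth q) w => ∑ r ∈ range (n + 1),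
      PowerSeries.coeff n (weightS μ r) * ((x (i.insertNth (1 : ℂ) w : V q) : ℂ) ^ r *
        ∑ A : Fin r → Fin (q + 1), dzIter A (pullback f) (i.insertNth (1 : ℂ) w : V q) *
          dzbarIter A (pullback g) (i.insertNth (1 : ℂ) w : V q)) := by
    refine IsBidiffOp.sum _ fun r hr => IsBidiffOp.mul_left (IsBidiffOp.mul_left
      (IsBidiffOp.sum _ fun A _ => IsDiffOp.mul ((isDiffOp_dzIter A).mono ?_)
        ((isDiffOp_dzbarIter A).mono ?_)) ?_) contDiff_const
    · exact Nat.lt_succ_iff.1 (mem_range.1 hr)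
    · exact Nat.lt_succ_iff.1 (mem_range.1 hr)
    · exact (contDiff_x.comp (contDiff_insertNth i)).pow r
  obtain ⟨a, ha, h⟩ := h
  refine ⟨a, ha, fun f g w => ?_⟩
  rw [← h f g w]
  refine (pb_apply_mk _ ⟨_, insertNth_one_ne_zero i w⟩).symm.trans ?_
  beta_reduce
  rw [coeff_starMul_C, map_sum, S_sum_apply]
  refine sum_congr rfl fun r _ => ?_
  rw [map_smul, S_smul, Pi.smul_apply, smul_eq_mul, pb_Mop_eq_M, M, contraction]

end DiffOp

/-! ### Assembly of the star product -/

theorem isStarProduct_starMul {q : ℕ} {μ : ℝ} (hμ : 0 < μ) : IsStarProduct μ (starMul q μ) where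
  assoc := starMul_assoc hμ
  one_left := starMul_one_left _
  one_right := starMul_one_right _
  zeroth f g := by
    rw [coeff_starMul_C]
    simp [weightS_zero, Mop_zero]
  first_order := first_order_starMul hμ
  conj := starMul_conj hμ.ne'
  bidifferential := isBidifferential_starMul _

end CPStar

end

theorem mainTheorem7 (q : ℕ) (μ : ℝ) (hμ : 0 < μ) :
    -- each `1 / (r! [c]_r)` is a power series in `λ` that starts in order `r` or later,
    -- so that the sum over `r` below is finite in each order of `λ`
    (∀ (r : ℕ) (n : ℤ), n < r → (CPStar.weight μ r).coeff n = 0) ∧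
    -- the operators `M_r` are homogeneous, in both of their forms
    (∀ (f g : CPStar.Smooth q) (r : ℕ),
      CPStar.IsHomogeneous (CPStar.M r (CPStar.pullback f) (CPStar.pullback g)) ∧
      ∀ z : CPStar.V q, z ≠ 0 →
        CPStar.M r (CPStar.pullback f) (CPStar.pullback g) z =
          (μ : ℂ) ^ r *
            CPStar.contraction r (CPStar.pullback f) (CPStar.pullback g) (CPStar.retract μ z)) ∧
    ∃ m : (CPStar.Smooth q)⟦X⟧ →ₗ[ℂ⟦X⟧] (CPStar.Smooth q)⟦X⟧ →ₗ[ℂ⟦X⟧] (CPStar.Smooth q)⟦X⟧,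
      CPStar.IsStarProduct μ m ∧
      -- `π^*(f * g) = ∑_r (1 / (r! [c]_r)) M_r(π^* f, π^* g)`, in each order `n` of `λ`
      (∀ (f g : CPStar.Smooth q) (n : ℕ) (z : CPStar.V q), z ≠ 0 →
        CPStar.pullback (PowerSeries.coeff n (m (PowerSeries.C f) (PowerSeries.C g))) z =
          ∑ r ∈ Finset.range (n + 1), (CPStar.weight μ r).coeff (n : ℤ) *
            CPStar.M r (CPStar.pullback f) (CPStar.pullback g) z) ∧
      -- `π^*(f * g) = P(π^* f ⋆ π^* g)`: it is the one and only homogeneous part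
      -- of the Wick product
      (∀ (f g : CPStar.Smooth q) (H : (CPStar.V q → ℂ)⟦X⟧),
        CPStar.IsHomogeneousPart μ
            (CPStar.wick (PowerSeries.C (CPStar.pullback f)) (PowerSeries.C (CPStar.pullback g))) H ↔
          ∀ (n : ℕ) (z : CPStar.V q), z ≠ 0 →
            PowerSeries.coeff n H z =
              CPStar.pullback (PowerSeries.coeff n (m (PowerSeries.C f) (PowerSeries.C g))) z) := by
  refine ⟨fun r n hn => CPStar.weight_coeff_of_lt hμ.ne' r n hn, fun f g r => ⟨?_, fun z hz =>
    CPStar.M_eq_retract hμ r f g ⟨z, hz⟩⟩, CPStar.starMul q μ, CPStar.isStarProduct_starMul hμ,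
    fun f g n z hz => ?_, fun f g H => CPStar.isHomogeneousPart_iff hμ f g H⟩
  · exact (CPStar.isHomogeneous_iff _ _ (CPStar.pb_Mop_eq_M r f g)).2 (CPStar.pb_mem_homAlg _)
  · rw [CPStar.coeff_starMul_C, ← CPStar.pb_apply _ ⟨z, hz⟩, map_sum, CPStar.S_sum_apply]
    refine Finset.sum_congr rfl fun r _ => ?_
    rw [map_smul, CPStar.S_smul, Pi.smul_apply, smul_eq_mul, CPStar.pb_Mop_eq_M,
      CPStar.weight_coeff_natCast hμ.ne']
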